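/- **Proposition (deflation error in the streaming setting).** Let $B>0$ and $\tau\ge 1$. There are constants $C_0,C_1,C_2>0$ depending only on $B$ and $\tau$ such that the following holds. *Data.* Let $d\ge 3$ and let $\mathcal D$ be a probability distribution on $\mathbb R^d$ that is $(B,1)$-round: for all $s\ge 1$ and all unit vectors $u\in\mathbb R^d$, $$\Pr_{x\sim\mathcal D}\{\|x\|>s\}\le e^{-s},\qquad \Pr_{x\sim\mathcal D}\{|u^\top x|>s\sqrt{B/d}\}\le e^{-s}.$$ Let $A=\mathbb E_{x\sim\mathcal D}[xx^\top]$ have an orthonormal eigenbasis $v_1,\dots,v_d$ with eigenvalues $1\ge\lambda_1>\lambda_2>\lambda_3\ge\cdots\ge\lambda_d\ (\ge 0)$. Let $x_1,x_2,\dots$ be i.i.d. with law $\mathcal D$. *Algorithm.* For a batch size $n$ put $\widehat A_t=\frac1n\sum_{i=(t-1)n+1}^{tn}x_ix_i^\top$. Given fixed unit vectors $q_0,w_0\in\mathbb R^d$, let for $t\ge 1$ $$q_t=\frac{\widehat A_tq_{t-1}}{\|\widehat A_tq_{t-1}\|},\qquad \nu_t=q_t^\top\widehat A_tq_t,\qquad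 w_t=\frac{(\widehat A_t-\nu_tq_tq_t^\top)w_{t-1}}{\|(\widehat A_t-\nu_tq_tq_t^\top)w_{t-1}\|}$$ (a vector with zero denominator is read as $0$), and let $G_t=(\lambda_1v_1v_1^\top-\nu_tq_tq_t^\top)w_{t-1}$. Let $\theta_0=\arccos|q_0^\top v_1|$ and assume $|q_0^\top v_1|\ge\frac{1}{\tau\sqrt d}$. *Choice of $n$.* Let $0<\epsilon<1/2$ and let $n\ge 2$ satisfy $$\frac{n}{\log^4 n}\ \ge\ C_0\,\frac{(1/\epsilon^2)\log d}{(\lambda_1-\lambda_2)^2\,d}.$$ *Bound.* For $t\ge 1$ let $$\phi_t=|\lambda_1-\lambda_d|\tan^2\theta_0\left|\frac{\lambda_2}{\lambda_1}\right|^{2t}+\min\left\{\frac{\epsilon(\lambda_1-\lambda_2)}{5},\frac{\lambda_1-\lambda_2}{5\sqrt d}\right\},$$ $$\psi_t=\sqrt{2-2\sqrt{1-\min\{1,\max\{\epsilon^2,(\lambda_2/\lambda_1)^{t/2}\tan^2\theta_0\}\}}}.$$ Then for every $T\ge 1$, with probability at least $1-C_2\,\frac{\max\{1,T/n\}}{n^2}$,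 $$\|G_t\|\le C_1\max\{\phi_t,\psi_t\}\qquad\text{for all } 1\le t\le T.$$ In particular, as long as $T\le n$, the bound holds simultaneously in the first $T$ rounds with all but $O(1/n^2)$ probability. -/

import Mathlib

open MeasureTheory ProbabilityTheory InnerProductSpace

noncomputable section

/-- The space `ℝ^d` with the Euclidean norm. -/
abbrev Vec (d : ℕ) : Type := EuclideanSpace ℝ (Fin d)

/-- The rank-one matrix `x xᵀ`, as an operator on `ℝ^d`. -/
def outer {d : ℕ} (x : Vec d) : Vec d →L[ℝ] Vec d := rankOne ℝ x x

/-- The (uncentered) covariance matrix `A = 𝔼[x xᵀ]` of a law on `ℝ^d`. -/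
def covMatrix {d : ℕ} (μ : Measure (Vec d)) : Vec d →L[ℝ] Vec d := ∫ x, outer x ∂μ

/-- The Hardt–Price tail condition on the law of the stream: a `(B, 1)`-round law. -/
structure IsRound {d : ℕ} (B : ℝ) (μ : Measure (Vec d)) : Prop where
  norm_tail : ∀ s : ℝ, 1 ≤ s → μ {x | s < ‖x‖} ≤ ENNReal.ofReal (Real.exp (-s))
  direction_tail : ∀ u : Vec d, ‖u‖ = 1 → ∀ s : ℝ, 1 ≤ s →
    μ {x | s * Real.sqrt (B / d) < |inner ℝ u x|} ≤ ENNReal.ofReal (Real.exp (-s))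

/-- The empirical estimate `Â_t = (1/n) ∑_{i=(t-1)n+1}^{tn} x_i x_iᵀ` of round `t ≥ 1`, for the
stream `x_1, x_2, …`. -/
def empCov {d : ℕ} (n : ℕ) (x : ℕ → Vec d) (t : ℕ) : Vec d →L[ℝ] Vec d :=
  (n : ℝ)⁻¹ • ∑ i ∈ Finset.Icc ((t - 1) * n + 1) (t * n), outer (x i)

/-- The power iterates `q_t = Â_t q_{t-1} / ‖Â_t q_{t-1}‖`. -/
def qIter {d : ℕ} (n : ℕ) (x : ℕ → Vec d) (q₀ : Vec d) : ℕ → Vec d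
  | 0 => q₀
  | t + 1 => NormedSpace.normalize (empCov n x (t + 1) (qIter n x q₀ t))

/-- The Rayleigh quotients `ν_t = q_tᵀ Â_t q_t`. -/
def nuIter {d : ℕ} (n : ℕ) (x : ℕ → Vec d) (q₀ : Vec d) (t : ℕ) : ℝ :=
  inner ℝ (qIter n x q₀ t) (empCov n x t (qIter n x q₀ t))

/-- The inexact deflation iterates: `w_t` is the normalization of
`(Â_t - ν_t q_t q_tᵀ) w_{t-1}`. -/
def wIter {d : ℕ} (n : ℕ) (x : ℕ → Vec d) (q₀ w₀ : Vec d) : ℕ → Vec d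
  | 0 => w₀
  | t + 1 => NormedSpace.normalize
      ((empCov n x (t + 1) - nuIter n x q₀ (t + 1) • outer (qIter n x q₀ (t + 1)))
        (wIter n x q₀ w₀ t))

/-- The deflation error `G_t = (λ₁ v₁ v₁ᵀ - ν_t q_t q_tᵀ) w_{t-1}` of round `t ≥ 1`. -/
def deflationError {d : ℕ} (n : ℕ) (x : ℕ → Vec d) (q₀ w₀ : Vec d) (lam₁ : ℝ) (v₁ : Vec d)
    (t : ℕ) : Vec d :=
  (lam₁ • outer v₁ - nuIter n x q₀ t • outer (qIter n x q₀ t)) (wIter n x q₀ w₀ (t - 1))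

/-- The angle `θ₀ = arccos |q₀ᵀ v₁|` between the lines spanned by two unit vectors. -/
def lineAngle {d : ℕ} (q v : Vec d) : ℝ := Real.arccos |inner ℝ q v|

/-- `φ_t`; the arguments are `λ₁`, `λ₂`, `λ_d`, the accuracy `ε`, the initial angle and `t`. -/
def phiBound (d : ℕ) (lam₁ lam₂ lamd ε θ₀ : ℝ) (t : ℕ) : ℝ :=
  |lam₁ - lamd| * Real.tan θ₀ ^ 2 * |lam₂ / lam₁| ^ (2 * t)
    + min (ε * (lam₁ - lam₂) / 5) ((lam₁ - lam₂) / (5 * Real.sqrt d))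

/-- `ψ_t`; the arguments are `λ₁`, `λ₂`, the accuracy `ε`, the initial angle and `t`. -/
def psiBound (lam₁ lam₂ ε θ₀ : ℝ) (t : ℕ) : ℝ :=
  Real.sqrt (2 - 2 * Real.sqrt
    (1 - min 1 (max (ε ^ 2) ((lam₂ / lam₁) ^ ((t : ℝ) / 2) * Real.tan θ₀ ^ 2))))

end

/-! Let `δ = (λ₁ - λ₂)/4` and `c₀ = 1/(τ√d)`. On a good event, every entry of `Â_t - A` in the
eigenbasis, and every coordinate of `(Â_t - A) q_{t-1}`, is at most `η = (B/d) · 5 log n / √n`; the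
choice of `n` gives `η ≤ ε δ c₀`. The noise then has norm at most `ε δ`, and at most `δ c₀` along
`v₁`. The power step therefore keeps `|⟨v₁, q_t⟩| ≥ c₀` and multiplies the tangent of the angle to
`v₁` by at most about `(λ₂/λ₁)^(1/4)` until it reaches `ε` (`noisy_power_step`, `qIter_trajectory`).

The deflation error is at most `d η + 4 λ₁ sin ∠(q_t, v₁)` (`norm_deflation_apply_le`). The
directional tails force `λ₁ = O(B/d)`, so `λ₁ tan θ₀` is bounded and `d η = O(ε)`. Both terms are
then `O(ψ_t)`; the summand `φ_t` of the maximum is never needed.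

For the good event, one entry is an average of `n` independent products with bounded moments. A
Chernoff bound for truncated variables makes it fail with probability `O(n⁻⁵)`. The vector `q_{t-1}`
is independent of batch `t`, so Fubini lets it count as fixed (`measure_inner_qIter_gt_le`). Since
`d ≤ n`, a union bound costs `O(n⁻³)` per round, hence `O(T/n³)` in all. -/

/-! ### Moments from exponential tails -/

/-- An upper bound for the `p`-th absolute moment of a random variable with
`P(|X| > s) ≤ exp (-s)` for `s ≥ 1`. -/
noncomputable def expTailMoment (p : ℕ) : ℝ :=
  1 + ∑' k : ℕ, ((k : ℝ) + 2) ^ p * Real.exp (-((k : ℝ) + 1))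

lemma summable_expTailMoment (p : ℕ) :
    Summable fun k : ℕ => ((k : ℝ) + 2) ^ p * Real.exp (-((k : ℝ) + 1)) := by
  have h := (summable_nat_add_iff 2).2
    (Real.summable_pow_mul_exp_neg_nat_mul p (r := 1) one_pos)
  refine (h.mul_left (Real.exp 1)).congr fun k => ?_
  rw [mul_left_comm, ← Real.exp_add]
  push_cast
  ring_nf

lemma one_le_expTailMoment (p : ℕ) : 1 ≤ expTailMoment p := by
  have : 0 ≤ ∑' k : ℕ, ((k : ℝ) + 2) ^ p * Real.exp (-((k : ℝ) + 1)) :=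
    tsum_nonneg fun k => by positivity
  unfold expTailMoment
  linarith

lemma lintegral_pow_le_of_exp_tail {Ω : Type*} [MeasurableSpace Ω] {μ : Measure Ω}
    [IsProbabilityMeasure μ] {X : Ω → ℝ} (hX : Measurable X)
    (h : ∀ s : ℝ, 1 ≤ s → μ {ω | s < |X ω|} ≤ ENNReal.ofReal (Real.exp (-s))) (p : ℕ) :
    ∫⁻ ω, ENNReal.ofReal (|X ω| ^ p) ∂μ ≤ ENNReal.ofReal (expTailMoment p) := by
  have hm : ∀ k : ℕ, MeasurableSet {ω | (k : ℝ) + 1 < |X ω|} := fun k =>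
    measurableSet_lt measurable_const hX.norm
  have hpt : ∀ ω, ENNReal.ofReal (|X ω| ^ p) ≤ 1 + ∑' k : ℕ,
      Set.indicator {ω | (k : ℝ) + 1 < |X ω|}
        (fun _ => ENNReal.ofReal (((k : ℝ) + 2) ^ p)) ω := by
    intro ω
    rcases le_or_gt |X ω| 1 with h1 | h1
    · refine le_add_right ?_
      rw [← ENNReal.ofReal_one]
      exact ENNReal.ofReal_le_ofReal (pow_le_one₀ (abs_nonneg _) h1)
    · refine le_add_left ?_
      -- Only the term with `k + 1 < |X ω| ≤ k + 2` is kept from the series.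
      have h2 : 2 ≤ ⌈|X ω|⌉₊ := Nat.lt_ceil.2 (by simpa using h1)
      obtain ⟨k, hk⟩ := Nat.exists_eq_add_of_le' h2
      have hlt : (k : ℝ) + 1 < |X ω| := by
        have : k + 1 < ⌈|X ω|⌉₊ := by omega
        simpa using Nat.lt_ceil.1 this
      have hle : |X ω| ≤ (k : ℝ) + 2 := by
        have := Nat.le_ceil |X ω|
        rw [hk] at this
        exact_mod_cast this
      refine le_trans ?_ (ENNReal.le_tsum k)
      rw [Set.indicator_of_mem (by exact hlt)]
      exact ENNReal.ofReal_le_ofReal (pow_le_pow_left₀ (abs_nonneg _) hle p)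
  calc ∫⁻ ω, ENNReal.ofReal (|X ω| ^ p) ∂μ
      ≤ ∫⁻ ω, (1 + ∑' k : ℕ, Set.indicator {ω | (k : ℝ) + 1 < |X ω|}
        (fun _ => ENNReal.ofReal (((k : ℝ) + 2) ^ p)) ω) ∂μ := lintegral_mono hpt
    _ = 1 + ∑' k : ℕ, ENNReal.ofReal (((k : ℝ) + 2) ^ p) * μ {ω | (k : ℝ) + 1 < |X ω|} := by
        rw [lintegral_add_left measurable_const, lintegral_tsum
          fun k => (measurable_const.indicator (hm k)).aemeasurable]
        simp only [lintegral_indicator (hm _), lintegral_const, measure_univ, mul_one,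
          Measure.restrict_apply MeasurableSet.univ, Set.univ_inter]
    _ ≤ 1 + ∑' k : ℕ, ENNReal.ofReal (((k : ℝ) + 2) ^ p * Real.exp (-((k : ℝ) + 1))) := by
        gcongr with k
        rw [ENNReal.ofReal_mul (by positivity)]
        gcongr
        exact h _ (by simp)
    _ = ENNReal.ofReal (expTailMoment p) := by
        rw [← ENNReal.ofReal_tsum_of_nonneg (fun k => by positivity) (summable_expTailMoment p),
          expTailMoment, ENNReal.ofReal_add zero_le_one (tsum_nonneg fun k => by positivity),
          ENNReal.ofReal_one]

lemma integrable_pow_of_exp_tail {Ω : Type*} [MeasurableSpace Ω] {μ : Measure Ω}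
    [IsProbabilityMeasure μ] {X : Ω → ℝ} (hX : Measurable X)
    (h : ∀ s : ℝ, 1 ≤ s → μ {ω | s < |X ω|} ≤ ENNReal.ofReal (Real.exp (-s))) (p : ℕ) :
    Integrable (fun ω => |X ω| ^ p) μ := by
  have hae : AEStronglyMeasurable (fun ω => |X ω| ^ p) μ :=
    (hX.norm.pow_const p).aestronglyMeasurable
  rw [← lintegral_ofReal_ne_top_iff_integrable hae (ae_of_all _ fun ω => by positivity)]
  exact ((lintegral_pow_le_of_exp_tail hX h p).trans_lt ENNReal.ofReal_lt_top).ne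

lemma integral_pow_le_of_exp_tail {Ω : Type*} [MeasurableSpace Ω] {μ : Measure Ω}
    [IsProbabilityMeasure μ] {X : Ω → ℝ} (hX : Measurable X)
    (h : ∀ s : ℝ, 1 ≤ s → μ {ω | s < |X ω|} ≤ ENNReal.ofReal (Real.exp (-s))) (p : ℕ) :
    ∫ ω, |X ω| ^ p ∂μ ≤ expTailMoment p := by
  have hm : AEStronglyMeasurable (fun ω => |X ω| ^ p) μ :=
    (hX.norm.pow_const p).aestronglyMeasurable
  rw [integral_eq_lintegral_of_nonneg_ae (ae_of_all _ fun ω => by positivity) hm]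
  exact ENNReal.toReal_le_of_le_ofReal (zero_le_one.trans (one_le_expTailMoment p))
    (lintegral_pow_le_of_exp_tail hX h p)

/-! ### A Chernoff bound with truncation -/

lemma exp_le_one_add_add_sq {z : ℝ} (hz : z ≤ 1) : Real.exp z ≤ 1 + z + z ^ 2 := by
  rcases le_or_gt (-1) z with h | h
  · have := (abs_le.1 (Real.abs_exp_sub_one_sub_id_le (abs_le.2 ⟨h, hz⟩))).2
    linarith
  · have : Real.exp z ≤ 1 := Real.exp_le_one_iff.2 (by linarith)
    nlinarith

/-- One truncated variable: its moment generating function at `θ = 1 / √n`. -/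
lemma mgf_min_le {Ω : Type*} [MeasurableSpace Ω] {P : Measure Ω} [IsProbabilityMeasure P]
    {Y : Ω → ℝ} (hY : Measurable Y) (hint : Integrable Y P) (hint2 : Integrable (fun ω => Y ω ^ 2) P)
    {m K : ℝ} (hm : ∫ ω, Y ω ∂P = m) (hK : ∫ ω, Y ω ^ 2 ∂P ≤ K) {r : ℝ} (hr : 0 < r) :
    mgf (fun ω => min (Y ω) r) P r⁻¹ ≤ Real.exp (r⁻¹ * m + K / r ^ 2) := by
  -- The right side involves the untruncated `Y`: where `Y ≥ r` the left side is `e ≤ 3`, below the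
  -- right side. Hence truncation from above creates no bias in the mean.
  have hle : ∀ ω, Real.exp (r⁻¹ * min (Y ω) r) ≤ 1 + r⁻¹ * Y ω + (r⁻¹) ^ 2 * Y ω ^ 2 := by
    intro ω
    rcases le_total (Y ω) r with h | h
    · rw [min_eq_left h]
      have h1 : r⁻¹ * Y ω ≤ 1 := by
        rw [inv_mul_le_iff₀ hr]; simpa using h
      have := exp_le_one_add_add_sq h1
      rwa [mul_pow] at this
    · rw [min_eq_right h, inv_mul_cancel₀ hr.ne']
      have h1 : 1 ≤ r⁻¹ * Y ω := by
        rw [le_inv_mul_iff₀ hr]; simpa using h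
      have := exp_le_one_add_add_sq (le_refl (1 : ℝ))
      nlinarith
  have hI1 : Integrable (fun ω => 1 + r⁻¹ * Y ω) P := (integrable_const 1).add (hint.const_mul _)
  have hI : Integrable (fun ω => 1 + r⁻¹ * Y ω + (r⁻¹) ^ 2 * Y ω ^ 2) P :=
    hI1.add (hint2.const_mul _)
  have hI' : Integrable (fun ω => Real.exp (r⁻¹ * min (Y ω) r)) P := by
    refine hI.mono' (by fun_prop) (ae_of_all _ fun ω => ?_)
    rw [Real.norm_eq_abs, abs_of_pos (Real.exp_pos _)]
    exact hle ω
  calc mgf (fun ω => min (Y ω) r) P r⁻¹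
      ≤ ∫ ω, (1 + r⁻¹ * Y ω + (r⁻¹) ^ 2 * Y ω ^ 2) ∂P := integral_mono hI' hI hle
    _ = 1 + r⁻¹ * m + (r⁻¹) ^ 2 * ∫ ω, Y ω ^ 2 ∂P := by
        rw [integral_add hI1 (hint2.const_mul _),
          integral_add (integrable_const 1) (hint.const_mul _), integral_const_mul,
          integral_const_mul, hm]
        simp
    _ ≤ 1 + r⁻¹ * m + (r⁻¹) ^ 2 * K := by gcongr
    _ = (r⁻¹ * m + K / r ^ 2) + 1 := by field_simp; ring
    _ ≤ _ := Real.add_one_le_exp _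

/-- A one-sided Bernstein-type bound for sums of independent variables with truncation at
`√n`. -/
lemma measure_sum_gt_le {Ω : Type*} [MeasurableSpace Ω] {P : Measure Ω} [IsProbabilityMeasure P]
    {Y : ℕ → Ω → ℝ} (hY : ∀ i, Measurable (Y i)) (hind : iIndepFun Y P) (S : Finset ℕ) {n : ℕ}
    (hn : 1 ≤ n) (hS : S.card = n) (hint : ∀ i, Integrable (Y i) P)
    (hint2 : ∀ i, Integrable (fun ω => Y i ω ^ 2) P) {m K : ℝ} (hm : ∀ i, ∫ ω, Y i ω ∂P = m)
    (hK : ∀ i, ∫ ω, Y i ω ^ 2 ∂P ≤ K) {δ : ENNReal}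
    (hδ : ∀ i, P {ω | Real.sqrt n < Y i ω} ≤ δ) :
    P {ω | n * m + 5 * Real.sqrt n * Real.log n < ∑ i ∈ S, Y i ω}
      ≤ ENNReal.ofReal (Real.exp K / (n : ℝ) ^ 5) + n * δ := by
  have hn0 : (0 : ℝ) < n := by exact_mod_cast hn
  set r : ℝ := Real.sqrt n with hr
  have hr0 : 0 < r := Real.sqrt_pos.2 hn0
  have hr2 : r ^ 2 = n := Real.sq_sqrt hn0.le
  set Z : ℕ → Ω → ℝ := fun i ω => min (Y i ω) r with hZ
  have hZm : ∀ i, Measurable (Z i) := fun i => (hY i).min measurable_const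
  have hZind : iIndepFun Z P :=
    hind.comp (fun _ y => min y r) fun _ => measurable_id.min measurable_const
  set a : ℝ := n * m + 5 * r * Real.log n with ha
  have hsub : {ω | a < ∑ i ∈ S, Y i ω} ⊆
      {ω | a ≤ (∑ i ∈ S, Z i) ω} ∪ ⋃ i ∈ S, {ω | r < Y i ω} := by
    intro ω hω
    by_cases hex : ∃ i ∈ S, r < Y i ω
    · right
      simpa using hex
    · left
      push Not at hex
      have : (∑ i ∈ S, Z i) ω = ∑ i ∈ S, Y i ω := by
        rw [Finset.sum_apply]
        exact Finset.sum_congr rfl fun i hi => min_eq_left (hex i hi)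
      show a ≤ (∑ i ∈ S, Z i) ω
      rw [this]
      exact le_of_lt hω
  have hbd : ∀ ω, (∑ i ∈ S, Z i) ω ≤ n * r := by
    intro ω
    rw [Finset.sum_apply, ← hS, ← nsmul_eq_mul]
    exact Finset.sum_le_card_nsmul _ _ _ fun i _ => min_le_right _ _
  have hint' : Integrable (fun ω => Real.exp (r⁻¹ * (∑ i ∈ S, Z i) ω)) P := by
    refine Integrable.of_bound (C := Real.exp (r⁻¹ * (n * r))) ?_ (ae_of_all _ fun ω => ?_)
    · have : Measurable (∑ i ∈ S, Z i) := by
        rw [Finset.sum_fn]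
        exact Finset.measurable_sum _ fun i _ => hZm i
      fun_prop
    · rw [Real.norm_eq_abs, abs_of_pos (Real.exp_pos _), Real.exp_le_exp]
      exact mul_le_mul_of_nonneg_left (hbd ω) (by positivity)
  have hch := measure_ge_le_exp_mul_mgf a (inv_nonneg.2 hr0.le) hint'
  have hmgf : mgf (∑ i ∈ S, Z i) P r⁻¹ ≤ Real.exp (r * m + K) := by
    rw [hZind.mgf_sum hZm]
    calc ∏ i ∈ S, mgf (Z i) P r⁻¹
        ≤ ∏ _i ∈ S, Real.exp (r⁻¹ * m + K / r ^ 2) :=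
          Finset.prod_le_prod (fun i _ => mgf_nonneg) fun i _ =>
            mgf_min_le (hY i) (hint i) (hint2 i) (hm i) (hK i) hr0
      _ = Real.exp (r * m + K) := by
          rw [Finset.prod_const, hS, ← Real.exp_nat_mul, ← hr2]
          congr 1
          field_simp
  -- With parameter `1/√n` the mean cancels and the deviation `5 √n log n` becomes the factor `n⁻⁵`.
  have hreal : P.real {ω | a ≤ (∑ i ∈ S, Z i) ω} ≤ Real.exp K / (n : ℝ) ^ 5 := by
    refine hch.trans ((mul_le_mul_of_nonneg_left hmgf (Real.exp_pos _).le).trans ?_)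
    have h5 : (n : ℝ) ^ 5 = Real.exp (5 * Real.log n) := by
      rw [mul_comm, Real.exp_mul, Real.exp_log hn0]
      norm_cast
    rw [h5, ← Real.exp_sub, ← Real.exp_add]
    apply le_of_eq
    congr 1
    rw [ha, ← hr2]
    field_simp
    ring
  calc P {ω | a < ∑ i ∈ S, Y i ω}
      ≤ P {ω | a ≤ (∑ i ∈ S, Z i) ω} + P (⋃ i ∈ S, {ω | r < Y i ω}) :=
        (measure_mono hsub).trans (measure_union_le _ _)
    _ ≤ _ := by
        gcongr
        · rw [← ENNReal.ofReal_toReal (measure_ne_top P _)]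
          exact ENNReal.ofReal_le_ofReal hreal
        · refine (measure_biUnion_finset_le _ _).trans ?_
          refine (Finset.sum_le_card_nsmul _ _ _ fun i _ => hδ i).trans ?_
          rw [hS, nsmul_eq_mul]

/-! ### Sampling error in fixed directions -/

lemma outer_apply {d : ℕ} (x y : Vec d) : outer x y = (inner ℝ x y) • x := by
  simp [outer, rankOne_apply]

lemma continuous_outer (d : ℕ) : Continuous (outer : Vec d → Vec d →L[ℝ] Vec d) := by
  exact (rankOne ℝ).continuous.clm_apply continuous_id

section Round

variable {d : ℕ} {B : ℝ} {μ : Measure (Vec d)}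

/-- Vectors of norm at most one are allowed because a normalized iterate may be the default value
`0`. -/
lemma IsRound.scaled_tail (h : IsRound B μ) {u : Vec d} (hu : ‖u‖ ≤ 1)
    (hb : 0 < B / d) {s : ℝ} (hs : 1 ≤ s) :
    μ {x | s < |inner ℝ u x / Real.sqrt (B / d)|} ≤ ENNReal.ofReal (Real.exp (-s)) := by
  have hr : 0 < Real.sqrt (B / d) := Real.sqrt_pos.2 hb
  rcases eq_or_ne u 0 with rfl | hu0
  · have : {x : Vec d | s < |inner ℝ (0 : Vec d) x / Real.sqrt (B / d)|} = ∅ := by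
      ext x
      simp
      linarith
    rw [this]
    simp
  · refine (measure_mono fun x hx => ?_).trans
      (h.direction_tail _ (NormedSpace.norm_normalize hu0) s hs)
    have hx' : s < |inner ℝ u x / Real.sqrt (B / d)| := hx
    rw [abs_div, abs_of_pos hr, lt_div_iff₀ hr] at hx'
    refine hx'.trans_le ?_
    have h1 : inner ℝ u x = ‖u‖ * inner ℝ (NormedSpace.normalize u) x := by
      rw [← real_inner_smul_left, NormedSpace.norm_smul_normalize]
    rw [h1, abs_mul, abs_of_nonneg (norm_nonneg _)]
    exact mul_le_of_le_one_left (abs_nonneg _) hu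

variable [IsProbabilityMeasure μ]

/-- The entry `uᵀ (x xᵀ) q`, normalized by `B / d`. -/
noncomputable def scaledEntry (B : ℝ) {d : ℕ} (u q x : Vec d) : ℝ :=
  inner ℝ u x / Real.sqrt (B / d) * (inner ℝ q x / Real.sqrt (B / d))

@[fun_prop]
lemma measurable_scaledEntry (u q : Vec d) : Measurable (scaledEntry B u q) := by
  unfold scaledEntry
  fun_prop

lemma abs_scaledEntry_pow_le (u q x : Vec d) (p : ℕ) :
    |scaledEntry B u q x| ^ p ≤ (|inner ℝ u x / Real.sqrt (B / d)| ^ (2 * p)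
      + |inner ℝ q x / Real.sqrt (B / d)| ^ (2 * p)) / 2 := by
  rw [scaledEntry, abs_mul, mul_pow, pow_mul', pow_mul']
  linarith [two_mul_le_add_sq (|inner ℝ u x / Real.sqrt (B / d)| ^ p)
    (|inner ℝ q x / Real.sqrt (B / d)| ^ p)]

lemma IsRound.integrable_scaledEntry_pow (h : IsRound B μ) (hb : 0 < B / d) {u q : Vec d}
    (hu : ‖u‖ ≤ 1) (hq : ‖q‖ ≤ 1) (p : ℕ) :
    Integrable (fun x => |scaledEntry B u q x| ^ p) μ := by
  have h1 := integrable_pow_of_exp_tail (by fun_prop) (fun s hs => h.scaled_tail hu hb hs) (2 * p)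
  have h2 := integrable_pow_of_exp_tail (by fun_prop) (fun s hs => h.scaled_tail hq hb hs) (2 * p)
  refine ((h1.add h2).div_const 2).mono' ?_ (ae_of_all _ fun x => ?_)
  · exact ((measurable_scaledEntry u q).norm.pow_const p).aestronglyMeasurable
  · rw [Real.norm_eq_abs, abs_of_nonneg (by positivity)]
    exact abs_scaledEntry_pow_le u q x p

lemma IsRound.integral_scaledEntry_pow_le (h : IsRound B μ) (hb : 0 < B / d) {u q : Vec d}
    (hu : ‖u‖ ≤ 1) (hq : ‖q‖ ≤ 1) (p : ℕ) :
    ∫ x, |scaledEntry B u q x| ^ p ∂μ ≤ expTailMoment (2 * p) := by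
  have h1 := integrable_pow_of_exp_tail (by fun_prop) (fun s hs => h.scaled_tail hu hb hs) (2 * p)
  have h2 := integrable_pow_of_exp_tail (by fun_prop) (fun s hs => h.scaled_tail hq hb hs) (2 * p)
  have h3 := integral_pow_le_of_exp_tail (by fun_prop)
    (fun s hs => h.scaled_tail hu hb hs) (2 * p)
  have h4 := integral_pow_le_of_exp_tail (by fun_prop)
    (fun s hs => h.scaled_tail hq hb hs) (2 * p)
  refine (integral_mono (h.integrable_scaledEntry_pow hb hu hq p) ((h1.add h2).div_const 2)
    fun x => abs_scaledEntry_pow_le u q x p).trans ?_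
  simp only [Pi.add_apply]
  rw [integral_div, integral_add h1 h2]
  linarith

lemma IsRound.integrable_scaledEntry (h : IsRound B μ) (hb : 0 < B / d) {u q : Vec d}
    (hu : ‖u‖ ≤ 1) (hq : ‖q‖ ≤ 1) : Integrable (scaledEntry B u q) μ := by
  have := h.integrable_scaledEntry_pow hb hu hq 1
  simp only [pow_one] at this
  exact (integrable_norm_iff (measurable_scaledEntry u q).aestronglyMeasurable).1 this

/-- Markov's inequality for the 12th power, since `(√n)^12 = n^6`. Summed over `n` samples this is
again `O(n⁻⁵)`, matching the Chernoff term. -/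
lemma IsRound.scaledEntry_tail (h : IsRound B μ) (hb : 0 < B / d) {u q : Vec d}
    (hu : ‖u‖ ≤ 1) (hq : ‖q‖ ≤ 1) {n : ℕ} (hn : 1 ≤ n) :
    μ {x | Real.sqrt n < scaledEntry B u q x}
      ≤ ENNReal.ofReal (expTailMoment 24 / (n : ℝ) ^ 6) := by
  have hn0 : (0 : ℝ) < n := by exact_mod_cast hn
  have hsub : {x | Real.sqrt n < scaledEntry B u q x}
      ⊆ {x | (n : ℝ) ^ 6 ≤ |scaledEntry B u q x| ^ 12} := by
    intro x hx
    have hx' : Real.sqrt n < scaledEntry B u q x := hx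
    have h1 : Real.sqrt n ≤ |scaledEntry B u q x| := hx'.le.trans (le_abs_self _)
    have h2 := pow_le_pow_left₀ (Real.sqrt_nonneg _) h1 12
    rwa [show (12 : ℕ) = 2 * 6 from rfl, pow_mul (Real.sqrt _), Real.sq_sqrt hn0.le] at h2
  have hmk := mul_meas_ge_le_integral_of_nonneg
    (ae_of_all μ fun x => by positivity) (h.integrable_scaledEntry_pow hb hu hq 12) ((n : ℝ) ^ 6)
  rw [← ENNReal.ofReal_toReal (measure_ne_top μ {x | Real.sqrt n < scaledEntry B u q x})]
  refine ENNReal.ofReal_le_ofReal ?_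
  rw [le_div_iff₀ (by positivity), mul_comm]
  refine le_trans ?_ (hmk.trans (h.integral_scaledEntry_pow_le hb hu hq 12))
  gcongr
  exact ENNReal.toReal_mono (measure_ne_top _ _) (measure_mono hsub)

lemma IsRound.integrable_outer (h : IsRound B μ) (hb : 0 < B / d) :
    Integrable (fun x : Vec d => outer x) μ := by
  -- The norm of `outer x` is at most `‖x‖²`, the sum of the squared coordinates, each integrable by
  -- its directional tail.
  have hs : Integrable (fun x : Vec d => ∑ i, ‖inner ℝ (EuclideanSpace.basisFun (Fin d) ℝ i) x‖ ^ 2)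
      μ := by
    refine integrable_finsetSum _ fun i _ => ?_
    have h1 := (h.integrable_scaledEntry_pow hb (u := EuclideanSpace.basisFun (Fin d) ℝ i)
      (q := EuclideanSpace.basisFun (Fin d) ℝ i) (by simp) (by simp) 1).const_mul (B / d)
    refine h1.congr (ae_of_all _ fun x => ?_)
    have hr : Real.sqrt (B / d) ^ 2 = B / d := Real.sq_sqrt hb.le
    have hr0 : Real.sqrt (B / d) ≠ 0 := (Real.sqrt_pos.2 hb).ne'
    simp only [scaledEntry, pow_one, Real.norm_eq_abs, sq_abs]
    rw [← hr, ← sq, abs_of_nonneg (sq_nonneg _), Real.sqrt_sq (Real.sqrt_nonneg _)]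
    field_simp
  refine hs.mono' (continuous_outer d).aestronglyMeasurable (ae_of_all _ fun x => ?_)
  rw [OrthonormalBasis.sum_sq_norm_inner_right]
  refine ContinuousLinearMap.opNorm_le_bound _ (by positivity) fun y => ?_
  rw [outer_apply, norm_smul, sq]
  calc ‖inner ℝ x y‖ * ‖x‖ ≤ (‖x‖ * ‖y‖) * ‖x‖ := by
        gcongr
        exact norm_inner_le_norm x y
    _ = _ := by ring

lemma inner_outer_apply (hb : 0 < B / d) (u q x : Vec d) :
    inner ℝ u (outer x q) = B / d * scaledEntry B u q x := by
  have hr : Real.sqrt (B / d) ^ 2 = B / d := Real.sq_sqrt hb.le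
  have hr0 : Real.sqrt (B / d) ≠ 0 := (Real.sqrt_pos.2 hb).ne'
  rw [outer_apply, real_inner_smul_right, scaledEntry, real_inner_comm x q, ← hr,
    Real.sqrt_sq (Real.sqrt_nonneg _)]
  field_simp

lemma IsRound.inner_covMatrix (h : IsRound B μ) (hb : 0 < B / d) (u q : Vec d) :
    inner ℝ u (covMatrix μ q) = B / d * ∫ x, scaledEntry B u q x ∂μ := by
  rw [covMatrix, ContinuousLinearMap.integral_apply (h.integrable_outer hb),
    ← integral_inner ((h.integrable_outer hb).apply_continuousLinearMap q), ← integral_const_mul]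
  exact integral_congr_ae (ae_of_all _ fun x => inner_outer_apply hb u q x)

lemma inner_empCov (hb : 0 < B / d) (n : ℕ) (x : ℕ → Vec d) (t : ℕ) (u q : Vec d) :
    inner ℝ u (empCov n x t q) = B / d * ((n : ℝ)⁻¹ *
      ∑ i ∈ Finset.Icc ((t - 1) * n + 1) (t * n), scaledEntry B u q (x i)) := by
  rw [empCov, _root_.smul_apply, real_inner_smul_right,
    _root_.sum_apply, inner_sum]
  simp only [inner_outer_apply hb]
  rw [← Finset.mul_sum]
  ring

lemma card_batch (n : ℕ) {t : ℕ} (ht : 1 ≤ t) :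
    (Finset.Icc ((t - 1) * n + 1) (t * n)).card = n := by
  obtain ⟨s, rfl⟩ := Nat.exists_eq_add_of_le' ht
  rw [Nat.card_Icc]
  simp [Nat.add_mul]

variable {Ω : Type*} [MeasurableSpace Ω] {P : Measure Ω} [IsProbabilityMeasure P]
  {x : ℕ → Ω → Vec d}

lemma IsRound.measure_inner_empCov_sub_gt_le (h : IsRound B μ) (hb : 0 < B / d)
    (hx : ∀ i, Measurable (x i)) (hlaw : ∀ i, P.map (x i) = μ) (hind : iIndepFun x P)
    {u q : Vec d} (hu : ‖u‖ ≤ 1) (hq : ‖q‖ ≤ 1) {n : ℕ} (hn : 1 ≤ n) {t : ℕ} (ht : 1 ≤ t) :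
    P {ω | B / d * (5 * Real.log n / Real.sqrt n)
        < inner ℝ u ((empCov n (fun i => x i ω) t - covMatrix μ) q)}
      ≤ ENNReal.ofReal ((Real.exp (expTailMoment 4) + expTailMoment 24) / (n : ℝ) ^ 5) := by
  have hn0 : (0 : ℝ) < n := by exact_mod_cast hn
  have hr0 : 0 < Real.sqrt n := Real.sqrt_pos.2 hn0
  have hr2 : Real.sqrt n ^ 2 = n := Real.sq_sqrt hn0.le
  have hmeas := measurable_scaledEntry (B := B) u q
  have hint : Integrable (scaledEntry B u q) μ := h.integrable_scaledEntry hb hu hq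
  have hint2 : Integrable (fun y => scaledEntry B u q y ^ 2) μ := by
    simpa only [sq_abs] using h.integrable_scaledEntry_pow hb hu hq 2
  have hK : ∫ y, scaledEntry B u q y ^ 2 ∂μ ≤ expTailMoment 4 := by
    simpa only [sq_abs] using h.integral_scaledEntry_pow_le hb hu hq 2
  have key := measure_sum_gt_le (P := P) (Y := fun i ω => scaledEntry B u q (x i ω))
    (fun i => hmeas.comp (hx i))
    (hind.comp (fun _ => scaledEntry B u q) fun _ => hmeas)
    (Finset.Icc ((t - 1) * n + 1) (t * n)) hn (card_batch n ht)
    (m := ∫ y, scaledEntry B u q y ∂μ) (K := expTailMoment 4)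
    (δ := ENNReal.ofReal (expTailMoment 24 / (n : ℝ) ^ 6))
    (fun i => by
      have := hint
      rw [← hlaw i] at this
      exact this.comp_measurable (hx i))
    (fun i => by
      have := hint2
      rw [← hlaw i] at this
      exact this.comp_measurable (hx i))
    (fun i => by
      rw [← hlaw i, integral_map (hx i).aemeasurable hmeas.aestronglyMeasurable])
    (fun i => by
      rw [← hlaw i, integral_map (hx i).aemeasurable
        (hmeas.pow_const 2).aestronglyMeasurable] at hK
      exact hK)
    (fun i => by
      have := h.scaledEntry_tail hb hu hq hn
      rwa [← hlaw i, Measure.map_apply (hx i) (measurableSet_lt measurable_const hmeas)] at this)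
  refine le_trans (measure_mono fun ω hω => ?_) (key.trans (le_of_eq ?_))
  · have hω' : B / d * (5 * Real.log n / Real.sqrt n)
        < inner ℝ u ((empCov n (fun i => x i ω) t - covMatrix μ) q) := hω
    rw [_root_.sub_apply, inner_sub_right, inner_empCov hb, h.inner_covMatrix hb,
      ← mul_sub] at hω'
    have h1 := lt_of_mul_lt_mul_left hω' hb.le
    rw [Set.mem_ofPred_eq]
    have h2 := mul_lt_mul_of_pos_left h1 hn0
    rw [mul_sub, mul_inv_cancel_left₀ hn0.ne'] at h2
    have h3 : (n : ℝ) * (5 * Real.log n / Real.sqrt n) = 5 * Real.sqrt n * Real.log n := by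
      rw [← hr2, Real.sqrt_sq hr0.le]
      field_simp
    rw [h3] at h2
    linarith
  · have hM := one_le_expTailMoment 24
    rw [← ENNReal.ofReal_natCast, ← ENNReal.ofReal_mul hn0.le,
      ← ENNReal.ofReal_add (by positivity) (by positivity)]
    congr 1
    field_simp

lemma IsRound.measure_abs_inner_empCov_sub_gt_le (h : IsRound B μ) (hb : 0 < B / d)
    (hx : ∀ i, Measurable (x i)) (hlaw : ∀ i, P.map (x i) = μ) (hind : iIndepFun x P)
    {u q : Vec d} (hu : ‖u‖ ≤ 1) (hq : ‖q‖ ≤ 1) {n : ℕ} (hn : 1 ≤ n) {t : ℕ} (ht : 1 ≤ t) :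
    P {ω | B / d * (5 * Real.log n / Real.sqrt n)
        < |inner ℝ u ((empCov n (fun i => x i ω) t - covMatrix μ) q)|}
      ≤ ENNReal.ofReal (2 * (Real.exp (expTailMoment 4) + expTailMoment 24) / (n : ℝ) ^ 5) := by
  have h1 := h.measure_inner_empCov_sub_gt_le hb hx hlaw hind hu hq hn ht
  have h2 := h.measure_inner_empCov_sub_gt_le hb hx hlaw hind (u := -u) (by simpa using hu)
    hq hn ht
  have hM := one_le_expTailMoment 24
  calc _ ≤ _ := measure_mono (fun ω hω => by
          rcases lt_abs.1 (Set.mem_ofPred_eq ▸ hω) with h | h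
          · exact Or.inl h
          · exact Or.inr (by simpa using h))
    _ ≤ _ := measure_union_le _ _
    _ ≤ _ := add_le_add h1 h2
    _ = _ := by
        rw [← ENNReal.ofReal_add (by positivity) (by positivity)]
        congr 1
        ring

end Round

/-! ### Measurability and independence of the iterates -/

section Adapted

variable {d : ℕ}

lemma empCov_apply (n : ℕ) (x : ℕ → Vec d) (t : ℕ) (q : Vec d) :
    empCov n x t q = (n : ℝ)⁻¹ •
      ∑ i ∈ Finset.Icc ((t - 1) * n + 1) (t * n), inner ℝ (x i) q • x i := by
  rw [empCov, _root_.smul_apply, _root_.sum_apply]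
  simp only [outer_apply]

lemma empCov_congr {n : ℕ} {x y : ℕ → Vec d} {t : ℕ}
    (h : ∀ i ∈ Finset.Icc ((t - 1) * n + 1) (t * n), x i = y i) :
    empCov n x t = empCov n y t := by
  unfold empCov
  rw [Finset.sum_congr rfl fun i hi => by rw [h i hi]]

lemma qIter_congr {n : ℕ} {x y : ℕ → Vec d} (q₀ : Vec d) (t : ℕ)
    (h : ∀ i ∈ Finset.Icc 1 (t * n), x i = y i) : qIter n x q₀ t = qIter n y q₀ t := by
  induction t with
  | zero => rfl
  | succ t ih =>
    have hle : t * n ≤ (t + 1) * n := Nat.mul_le_mul_right n t.le_succ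
    rw [qIter, qIter, ih fun i hi => h i (by simp only [Finset.mem_Icc] at hi ⊢; omega),
      empCov_congr fun i hi => h i (by
        simp only [Finset.mem_Icc, Nat.add_sub_cancel] at hi ⊢
        omega)]

lemma norm_normalize_le_one {V : Type*} [NormedAddCommGroup V] [NormedSpace ℝ V] (z : V) :
    ‖NormedSpace.normalize z‖ ≤ 1 := by
  rcases eq_or_ne z 0 with rfl | hz
  · simp
  · exact (NormedSpace.norm_normalize hz).le

lemma norm_qIter_le_one {n : ℕ} {x : ℕ → Vec d} {q₀ : Vec d} (h : ‖q₀‖ ≤ 1) (t : ℕ) :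
    ‖qIter n x q₀ t‖ ≤ 1 := by
  cases t with
  | zero => exact h
  | succ t => exact norm_normalize_le_one _

lemma norm_wIter_le_one {n : ℕ} {x : ℕ → Vec d} {q₀ w₀ : Vec d} (h : ‖w₀‖ ≤ 1) (t : ℕ) :
    ‖wIter n x q₀ w₀ t‖ ≤ 1 := by
  cases t with
  | zero => exact h
  | succ t => exact norm_normalize_le_one _

variable {Z : Type*} [MeasurableSpace Z]

lemma measurable_empCov_apply {n : ℕ} {x : ℕ → Z → Vec d} (hx : ∀ i, Measurable (x i)) (t : ℕ)
    {q : Z → Vec d} (hq : Measurable q) :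
    Measurable fun z => empCov n (fun i => x i z) t (q z) := by
  simp only [empCov_apply]
  have h : ∀ i, Measurable fun z => inner ℝ (x i z) (q z) • x i z := fun i =>
    (Measurable.inner (𝕜 := ℝ) (hx i) hq).smul (hx i)
  exact (Finset.measurable_sum _ fun i _ => h i).const_smul (n : ℝ)⁻¹

lemma measurable_qIter {n : ℕ} {x : ℕ → Z → Vec d} (hx : ∀ i, Measurable (x i)) (q₀ : Vec d)
    (t : ℕ) : Measurable fun z => qIter n (fun i => x i z) q₀ t := by
  induction t with
  | zero => exact measurable_const
  | succ t ih =>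
    have h := measurable_empCov_apply (n := n) hx (t + 1) ih
    simp only [qIter, NormedSpace.normalize]
    exact h.norm.inv.smul h

/-- Extend a finite batch by zero to a stream. -/
def extendBatch (S : Finset ℕ) (y : S → Vec d) (i : ℕ) : Vec d :=
  if h : i ∈ S then y ⟨i, h⟩ else 0

lemma measurable_extendBatch (S : Finset ℕ) (i : ℕ) :
    Measurable fun y : S → Vec d => extendBatch S y i := by
  unfold extendBatch
  split_ifs with h
  · exact measurable_pi_apply _
  · exact measurable_const

lemma extendBatch_of_mem {S : Finset ℕ} (x : ℕ → Vec d) {i : ℕ} (h : i ∈ S) :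
    extendBatch S (fun j : S => x j) i = x i := by
  simp [extendBatch, h]

/-- A tail bound for fixed directions passes to the iterate of the previous round, which is
independent of the current batch. -/
lemma measure_inner_qIter_gt_le {Ω : Type*} [MeasurableSpace Ω] {P : Measure Ω}
    [IsProbabilityMeasure P] {x : ℕ → Ω → Vec d} (hx : ∀ i, Measurable (x i))
    (hind : iIndepFun x P) (n t : ℕ) {q₀ : Vec d} (hq₀ : ‖q₀‖ ≤ 1) (M : Vec d →L[ℝ] Vec d)
    (u : Vec d) (c : ℝ) (C : ENNReal)
    (h : ∀ q : Vec d, ‖q‖ ≤ 1 →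
      P {ω | c < |inner ℝ u ((empCov n (fun i => x i ω) (t + 1) - M) q)|} ≤ C) :
    P {ω | c < |inner ℝ u ((empCov n (fun i => x i ω) (t + 1) - M)
      (qIter n (fun i => x i ω) q₀ t))|} ≤ C := by
  set S₁ := Finset.Icc 1 (t * n)
  set S₂ := Finset.Icc (t * n + 1) ((t + 1) * n)
  have hdisj : Disjoint S₁ S₂ := by
    rw [Finset.disjoint_left]
    intro i h1 h2
    simp only [S₁, S₂, Finset.mem_Icc] at h1 h2
    omega
  set Q : Ω → Vec d := fun ω => qIter n (fun i => x i ω) q₀ t with hQdef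
  set W : Ω → S₂ → Vec d := fun ω i => x i ω with hWdef
  have hQ : Measurable Q := measurable_qIter hx q₀ t
  have hW : Measurable W := measurable_pi_lambda _ fun i => hx i
  -- The iterate is a measurable function of the samples in `S₁` alone; zero extension lets `qIter`
  -- be evaluated on that finite family.
  have hQW : IndepFun Q W P := by
    have h1 := (hind.indepFun_finset S₁ S₂ hdisj hx).comp
      (measurable_qIter (n := n) (measurable_extendBatch S₁) q₀ t) measurable_id
    have h2 : Q = (fun y : S₁ → Vec d => qIter n (fun i => extendBatch S₁ y i) q₀ t) ∘
        (fun ω (i : S₁) => x i ω) := by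
      funext ω
      exact qIter_congr q₀ t fun i hi => (extendBatch_of_mem (fun j => x j ω) hi).symm
    rw [h2]
    exact h1
  have hcov : ∀ ω, empCov n (fun i => extendBatch S₂ (W ω) i) (t + 1)
      = empCov n (fun i => x i ω) (t + 1) := fun ω =>
    empCov_congr fun i hi => extendBatch_of_mem (fun j => x j ω) (by simpa [S₂] using hi)
  have hfun : Measurable fun p : Vec d × (S₂ → Vec d) =>
      inner ℝ u ((empCov n (fun i => extendBatch S₂ p.2 i) (t + 1) - M) p.1) := by
    have h1 := measurable_empCov_apply (n := n)
      (x := fun i (p : Vec d × (S₂ → Vec d)) => extendBatch S₂ p.2 i)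
      (fun i => (measurable_extendBatch S₂ i).comp measurable_snd) (t + 1) measurable_fst
    have h2 : Measurable fun p : Vec d × (S₂ → Vec d) => M p.1 :=
      M.continuous.measurable.comp measurable_fst
    exact measurable_const.inner (h1.sub h2)
  -- The norm constraint empties the slices over `‖q‖ > 1`, where `h` says nothing.
  set s : Set (Vec d × (S₂ → Vec d)) := {p | ‖p.1‖ ≤ 1 ∧
    c < |inner ℝ u ((empCov n (fun i => extendBatch S₂ p.2 i) (t + 1) - M) p.1)|} with hs
  have hsm : MeasurableSet s :=
    (measurableSet_le measurable_fst.norm measurable_const).inter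
      (measurableSet_lt measurable_const hfun.norm)
  have heq : {ω | c < |inner ℝ u ((empCov n (fun i => x i ω) (t + 1) - M)
      (qIter n (fun i => x i ω) q₀ t))|} ⊆ (fun ω => (Q ω, W ω)) ⁻¹' s := by
    intro ω hω
    refine ⟨norm_qIter_le_one hq₀ t, ?_⟩
    rw [hcov]
    exact hω
  refine (measure_mono heq).trans ?_
  rw [← Measure.map_apply (hQ.prodMk hW) hsm,
    (indepFun_iff_map_prod_eq_prod_map_map hQ.aemeasurable hW.aemeasurable).1 hQW]
  have : IsProbabilityMeasure (P.map Q) := Measure.isProbabilityMeasure_map hQ.aemeasurable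
  have : IsProbabilityMeasure (P.map W) := Measure.isProbabilityMeasure_map hW.aemeasurable
  rw [Measure.prod_apply hsm]
  calc _ ≤ ∫⁻ _ : Vec d, C ∂(P.map Q) := by
        refine lintegral_mono fun q => ?_
        rw [Measure.map_apply hW (measurable_prodMk_left hsm)]
        by_cases hq : ‖q‖ ≤ 1
        · refine (measure_mono fun ω hω => ?_).trans (h q hq)
          have := hω.2
          rwa [hcov] at this
        · have : W ⁻¹' (Prod.mk q ⁻¹' s) = ∅ := by
            ext ω
            simp [hs, hq]
          rw [this]
          simp
    _ = C := by simp

end Adapted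

/-! ### Angle to a line -/

section Perp

variable {E : Type*} [NormedAddCommGroup E] [InnerProductSpace ℝ E]

/-- The component of `q` orthogonal to the unit vector `v`. -/
def perp (v q : E) : E := q - (inner ℝ v q : ℝ) • v

lemma perp_add (v p q : E) : perp v (p + q) = perp v p + perp v q := by
  unfold perp
  rw [inner_add_right, add_smul]
  abel

lemma perp_smul (v q : E) (r : ℝ) : perp v (r • q) = r • perp v q := by
  unfold perp
  rw [real_inner_smul_right, smul_sub, smul_smul]

lemma inner_perp {v : E} (hv : ‖v‖ = 1) (q : E) : inner ℝ v (perp v q) = 0 := by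
  rw [perp, inner_sub_right, real_inner_smul_right, real_inner_self_eq_norm_sq, hv]
  ring

lemma norm_perp_sq {v : E} (hv : ‖v‖ = 1) (q : E) :
    ‖perp v q‖ ^ 2 = ‖q‖ ^ 2 - inner ℝ v q ^ 2 := by
  rw [perp, norm_sub_sq_real, norm_smul, hv, real_inner_smul_right, real_inner_comm v q, mul_pow,
    Real.norm_eq_abs, sq_abs]
  ring

lemma norm_perp_le {v : E} (hv : ‖v‖ = 1) (q : E) : ‖perp v q‖ ≤ ‖q‖ := by
  refine le_of_sq_le_sq ?_ (norm_nonneg _)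
  rw [norm_perp_sq hv]
  linarith [sq_nonneg (inner ℝ v q : ℝ)]

/-- The tangent of the angle between the lines spanned by `v` and `q`. -/
noncomputable def tanAngle (v q : E) : ℝ := ‖perp v q‖ / |inner ℝ v q|

lemma tanAngle_nonneg (v q : E) : 0 ≤ tanAngle v q := by
  unfold tanAngle
  positivity

lemma tanAngle_smul (v q : E) {r : ℝ} (hr : r ≠ 0) : tanAngle v (r • q) = tanAngle v q := by
  rw [tanAngle, tanAngle, perp_smul, norm_smul, real_inner_smul_right, abs_mul, Real.norm_eq_abs,
    mul_div_mul_left _ _ (abs_ne_zero.2 hr)]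

lemma tanAngle_sq {v q : E} (hv : ‖v‖ = 1) (hq : ‖q‖ = 1) (h : inner ℝ v q ≠ (0 : ℝ)) :
    tanAngle v q ^ 2 = 1 / inner ℝ v q ^ 2 - 1 := by
  rw [tanAngle, div_pow, sq_abs, norm_perp_sq hv, hq]
  field_simp

lemma abs_inner_le_one {v q : E} (hv : ‖v‖ = 1) (hq : ‖q‖ = 1) : |inner ℝ v q| ≤ (1 : ℝ) := by
  simpa [hv, hq] using abs_real_inner_le_norm v q

lemma norm_perp_le_tanAngle {v q : E} (hv : ‖v‖ = 1) (hq : ‖q‖ = 1)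
    (h : inner ℝ v q ≠ (0 : ℝ)) : ‖perp v q‖ ≤ tanAngle v q := by
  rw [tanAngle, le_div_iff₀ (abs_pos.2 h)]
  exact mul_le_of_le_one_right (norm_nonneg _) (abs_inner_le_one hv hq)

lemma tanAngle_le_inv {v q : E} (hv : ‖v‖ = 1) (hq : ‖q‖ = 1) :
    tanAngle v q ≤ |inner ℝ v q|⁻¹ := by
  rw [tanAngle, div_eq_mul_inv]
  exact mul_le_of_le_one_left (by positivity) (hq ▸ norm_perp_le hv q)

end Perp

lemma tan_lineAngle_sq {d : ℕ} {v q : Vec d} (hv : ‖v‖ = 1) (hq : ‖q‖ = 1) :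
    Real.tan (lineAngle q v) ^ 2 = tanAngle v q ^ 2 := by
  rw [lineAngle, Real.tan_arccos, tanAngle, div_pow, div_pow, norm_perp_sq hv, hq,
    real_inner_comm, sq_abs, Real.sq_sqrt]
  · ring
  · have := abs_inner_le_one hv hq
    rw [← sq_abs] at *
    nlinarith [abs_nonneg (inner ℝ v q : ℝ)]

/-! ### One noisy power step -/

section Step

/-- The scalar inequality behind one step of the noisy power method. -/
lemma noisy_ratio_le {l δ ε c s g h N D : ℝ} (hl : 0 ≤ l) (hδ : 0 < δ) (hc : 0 < c) (hs : 0 ≤ s)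
    (hε : 0 ≤ ε) (hcs : 1 ≤ c + s) (hg : g ≤ ε * δ) (hh : h ≤ δ * c) (hN : N ≤ l * s + g)
    (hD : (l + 4 * δ) * c - h ≤ D) :
    N / D ≤ max ε (max ε (l / (l + δ)) * (s / c)) := by
  have hD0 : (l + 3 * δ) * c ≤ D := by linarith
  have hDpos : 0 < D := lt_of_lt_of_le (by positivity) hD0
  rw [div_le_iff₀ hDpos]
  set ρ := max ε (l / (l + δ)) with hρ
  set m := max ε (ρ * (s / c)) with hm
  have hm0 : 0 ≤ m := hε.trans (le_max_left _ _)
  have hρε : ε ≤ ρ := le_max_left _ _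
  have hρl : l ≤ ρ * (l + δ) := (div_le_iff₀ (by positivity)).1 (le_max_right _ _)
  have hmε : ε ≤ m := le_max_left _ _
  have hms : ρ * s ≤ m * c := by
    have : ρ * (s / c) ≤ m := le_max_right _ _
    rwa [← mul_div_assoc, div_le_iff₀ hc] at this
  -- A mediant argument: `N ≤ (l + εδ)s + εδc` and `D ≥ (l + 2δ)c + δc`. The first parts have ratio
  -- at most `ρ s / c`, the second parts ratio `ε`.
  have h1 : ε * δ ≤ ε * δ * (c + s) := le_mul_of_one_le_right (by positivity) hcs
  have h2 : (l + ε * δ) * s ≤ ρ * (l + 2 * δ) * s :=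
    mul_le_mul_of_nonneg_right (by nlinarith) hs
  have h3 : ρ * s * (l + 2 * δ) ≤ m * c * (l + 2 * δ) :=
    mul_le_mul_of_nonneg_right hms (by positivity)
  have h4 : ε * (δ * c) ≤ m * (δ * c) := mul_le_mul_of_nonneg_right hmε (by positivity)
  have h5 : m * ((l + 3 * δ) * c) ≤ m * D := mul_le_mul_of_nonneg_left hD0 hm0
  nlinarith

/-- Bernoulli's inequality for the exponent 4. With `λ₁ = l + 4δ`, the contraction factor is at most
`(λ₂/λ₁)^(1/4)`, whence the exponent `t/2` for squared tangents. -/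
lemma pow_four_div_add_le {l δ : ℝ} (hl : 0 ≤ l) (hδ : 0 < δ) :
    (l / (l + δ)) ^ 4 ≤ l / (l + 4 * δ) := by
  rw [div_pow, div_le_div_iff₀ (by positivity) (by positivity)]
  have h : l * (l + δ) ^ 4 - l ^ 4 * (l + 4 * δ)
      = l * (6 * l ^ 2 * δ ^ 2 + 4 * l * δ ^ 3 + δ ^ 4) := by ring
  have : 0 ≤ l * (6 * l ^ 2 * δ ^ 2 + 4 * l * δ ^ 3 + δ ^ 4) := by positivity
  linarith

variable {d : ℕ} {A : Vec d →L[ℝ] Vec d} {lam : Fin d → ℝ}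
  {v : OrthonormalBasis (Fin d) ℝ (Vec d)}

lemma inner_eigenbasis_apply (hA : ∀ i, A (v i) = lam i • v i) (i : Fin d) (q : Vec d) :
    inner ℝ (v i) (A q) = lam i * inner ℝ (v i) q := by
  conv_lhs => rw [← v.sum_repr' q]
  rw [map_sum, inner_sum, Finset.sum_eq_single i]
  · rw [map_smul, hA, real_inner_smul_right, real_inner_smul_right, real_inner_self_eq_norm_sq,
      v.norm_eq_one]
    ring
  · intro j _ hj
    rw [map_smul, hA, real_inner_smul_right, real_inner_smul_right,
      v.inner_eq_zero hj.symm]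
    simp
  · simp

lemma perp_eigenvector_apply (hA : ∀ i, A (v i) = lam i • v i) (i : Fin d) (q : Vec d) :
    perp (v i) (A q) = A (perp (v i) q) := by
  rw [perp, perp, inner_eigenbasis_apply hA, map_sub, map_smul, hA, smul_smul, mul_comm]

lemma norm_apply_perp_le (hA : ∀ i, A (v i) = lam i • v i) (hlam : ∀ i, 0 ≤ lam i) {i₀ : Fin d}
    {l : ℝ} (hl : 0 ≤ l) (hle : ∀ i, i ≠ i₀ → lam i ≤ l) (q : Vec d) :
    ‖A (perp (v i₀) q)‖ ≤ l * ‖perp (v i₀) q‖ := by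
  refine le_of_sq_le_sq ?_ (by positivity)
  rw [mul_pow, ← v.sum_sq_norm_inner_right, ← v.sum_sq_norm_inner_right, Finset.mul_sum]
  refine Finset.sum_le_sum fun i _ => ?_
  rw [inner_eigenbasis_apply hA, norm_mul, mul_pow]
  by_cases hi : i = i₀
  · rw [hi, inner_perp (v.norm_eq_one i₀)]
    simp
  · gcongr
    rw [Real.norm_eq_abs, abs_of_nonneg (hlam i)]
    exact hle i hi

/-- One step of the noisy power method. -/
lemma noisy_power_step (hA : ∀ i, A (v i) = lam i • v i) (hlam : ∀ i, 0 ≤ lam i) {i₀ : Fin d}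
    {l δ ε c₀ : ℝ} (hl : 0 ≤ l) (hle : ∀ i, i ≠ i₀ → lam i ≤ l) (hδ : 0 < δ)
    (hgap : lam i₀ = l + 4 * δ) (hε : 0 ≤ ε) (hc₀ : 0 < c₀) (hεc : ε ^ 2 ≤ 1 / c₀ ^ 2 - 1)
    {q g : Vec d} (hq : ‖q‖ = 1) (hqc : c₀ ≤ |inner ℝ (v i₀) q|) (hg : ‖g‖ ≤ ε * δ)
    (hg₀ : |inner ℝ (v i₀) g| ≤ δ * c₀) (hε1 : ε ≤ 1) :
    ‖NormedSpace.normalize (A q + g)‖ = 1 ∧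
      c₀ ≤ |inner ℝ (v i₀) (NormedSpace.normalize (A q + g))| ∧
      tanAngle (v i₀) (NormedSpace.normalize (A q + g))
        ≤ max ε (max ε (l / (l + δ)) * tanAngle (v i₀) q) := by
  have hv := v.norm_eq_one i₀
  set c := |inner ℝ (v i₀) q| with hc
  have hc0 : 0 < c := hc₀.trans_le hqc
  have hD : (l + 4 * δ) * c - |inner ℝ (v i₀) g| ≤ |inner ℝ (v i₀) (A q + g)| := by
    rw [inner_add_right, inner_eigenbasis_apply hA, hgap]
    have h1 : |(l + 4 * δ) * inner ℝ (v i₀) q| = (l + 4 * δ) * c := by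
      rw [abs_mul, abs_of_pos (by positivity)]
    have h2 := abs_sub_abs_le_abs_sub ((l + 4 * δ) * inner ℝ (v i₀) q) (-inner ℝ (v i₀) g)
    rwa [h1, abs_neg, sub_neg_eq_add] at h2
  have hgc : |inner ℝ (v i₀) g| ≤ δ * c := hg₀.trans (by gcongr)
  have hDpos : 0 < |inner ℝ (v i₀) (A q + g)| := by
    have : 0 < (l + 3 * δ) * c := by positivity
    linarith
  have hne : A q + g ≠ 0 := by
    intro h0
    rw [h0] at hDpos
    simp at hDpos
  have hN : ‖perp (v i₀) (A q + g)‖ ≤ l * ‖perp (v i₀) q‖ + ‖g‖ := by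
    rw [perp_add, perp_eigenvector_apply hA]
    exact (norm_add_le _ _).trans
      (add_le_add (norm_apply_perp_le hA hlam hl hle q) (norm_perp_le hv g))
  have hcs : 1 ≤ c + ‖perp (v i₀) q‖ := by
    have h1 := norm_perp_sq hv q
    rw [hq, ← sq_abs (inner ℝ (v i₀) q)] at h1
    nlinarith [norm_nonneg (perp (v i₀) q)]
  have htan : tanAngle (v i₀) (NormedSpace.normalize (A q + g))
      ≤ max ε (max ε (l / (l + δ)) * tanAngle (v i₀) q) := by
    rw [NormedSpace.normalize, tanAngle_smul _ _ (inv_ne_zero (norm_ne_zero_iff.2 hne))]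
    exact noisy_ratio_le hl hδ hc0 (norm_nonneg _) hε hcs hg hgc hN hD
  have hnorm := NormedSpace.norm_normalize hne
  refine ⟨hnorm, ?_, htan⟩
  have hin : inner ℝ (v i₀) (NormedSpace.normalize (A q + g)) ≠ (0 : ℝ) := by
    rw [NormedSpace.normalize, real_inner_smul_right]
    exact mul_ne_zero (inv_ne_zero (norm_ne_zero_iff.2 hne)) (abs_pos.1 hDpos)
  have hρ : max ε (l / (l + δ)) ≤ 1 :=
    max_le hε1 ((div_le_one (by positivity)).2 (by linarith))
  -- For unit vectors the lower bound `c₀` on the cosine amounts to `tan² ≤ 1/c₀² - 1`, which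
  -- survives because the new tangent is at most the larger of `ε` and the old one.
  have h1 : tanAngle (v i₀) (NormedSpace.normalize (A q + g)) ^ 2 ≤ 1 / c₀ ^ 2 - 1 := by
    rcases le_max_iff.1 htan with h | h
    · exact (pow_le_pow_left₀ (tanAngle_nonneg _ _) h 2).trans hεc
    · have h2 := pow_le_pow_left₀ (tanAngle_nonneg _ _)
        (h.trans (mul_le_of_le_one_left (tanAngle_nonneg _ _) hρ)) 2
      rw [tanAngle_sq hv hq (abs_pos.1 hc0), ← sq_abs (inner ℝ (v i₀) q)] at h2
      have h3 : 1 / c ^ 2 ≤ 1 / c₀ ^ 2 := by gcongr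
      linarith
  rw [tanAngle_sq hv hnorm hin] at h1
  have h2 := (one_div_le_one_div (sq_pos_of_ne_zero hin) (by positivity)).1
    (by linarith : 1 / inner ℝ (v i₀) (NormedSpace.normalize (A q + g)) ^ 2 ≤ 1 / c₀ ^ 2)
  rw [← abs_of_pos hc₀]
  exact sq_le_sq.1 h2

end Step

/-! ### Deflation error from angle and entrywise error -/

section Deflation

variable {d : ℕ} {A : Vec d →L[ℝ] Vec d} {lam : Fin d → ℝ}
  {v : OrthonormalBasis (Fin d) ℝ (Vec d)}

lemma norm_le_of_abs_inner_basis_le (v : OrthonormalBasis (Fin d) ℝ (Vec d)) {g : Vec d} {η : ℝ}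
    (hη : 0 ≤ η) (h : ∀ i, |inner ℝ (v i) g| ≤ η) : ‖g‖ ≤ Real.sqrt d * η := by
  refine le_of_sq_le_sq ?_ (by positivity)
  rw [mul_pow, Real.sq_sqrt (Nat.cast_nonneg d), ← v.sum_sq_norm_inner_right]
  refine (Finset.sum_le_card_nsmul _ _ (η ^ 2) fun i _ => ?_).trans (by simp)
  exact pow_le_pow_left₀ (norm_nonneg _) (h i) 2

lemma sum_abs_inner_basis_le (v : OrthonormalBasis (Fin d) ℝ (Vec d)) (q : Vec d) :
    ∑ i, |inner ℝ (v i) q| ≤ Real.sqrt d * ‖q‖ := by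
  refine le_of_sq_le_sq ?_ (by positivity)
  rw [mul_pow, Real.sq_sqrt (Nat.cast_nonneg d), ← v.sum_sq_norm_inner_right]
  simpa using sq_sum_le_card_mul_sum_sq (s := Finset.univ) (f := fun i => |inner ℝ (v i) q|)

/-- Uniformity in `q` is essential: `q_t` is built from the same batch as `Â_t`, so no independence
is available in `ν_t`. The price is a factor `√d` for each argument. -/
lemma abs_inner_apply_le_of_entries (v : OrthonormalBasis (Fin d) ℝ (Vec d))
    {M : Vec d →L[ℝ] Vec d} {η : ℝ} (hη : 0 ≤ η)
    (h : ∀ i j, |inner ℝ (v i) (M (v j))| ≤ η) {q : Vec d} (hq : ‖q‖ = 1) :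
    |inner ℝ q (M q)| ≤ d * η := by
  have h1 : ∀ i, |inner ℝ (v i) (M q)| ≤ Real.sqrt d * η := by
    intro i
    conv_lhs => rw [← v.sum_repr' q]
    rw [map_sum, inner_sum]
    calc _ ≤ ∑ j, |inner ℝ (v j) q| * η := by
          refine (Finset.abs_sum_le_sum_abs _ _).trans (Finset.sum_le_sum fun j _ => ?_)
          rw [map_smul, real_inner_smul_right, abs_mul]
          exact mul_le_mul_of_nonneg_left (h i j) (abs_nonneg _)
      _ ≤ Real.sqrt d * η := by
          rw [← Finset.sum_mul]
          gcongr
          simpa [hq] using sum_abs_inner_basis_le v q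
  have h2 := norm_le_of_abs_inner_basis_le v (by positivity) h1
  refine (abs_real_inner_le_norm _ _).trans ?_
  rw [hq, one_mul]
  refine h2.trans (le_of_eq ?_)
  rw [← mul_assoc, Real.mul_self_sqrt (Nat.cast_nonneg d)]

/-- The Rayleigh quotient averages the eigenvalues with weight `cos²` on `lam i₀`, so it lies
between `lam i₀ * cos²` and `lam i₀`. -/
lemma abs_rayleigh_sub_le (hA : ∀ i, A (v i) = lam i • v i) (hlam : ∀ i, 0 ≤ lam i) {i₀ : Fin d}
    (hle : ∀ i, lam i ≤ lam i₀) {q : Vec d} (hq : ‖q‖ = 1) :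
    |lam i₀ - inner ℝ q (A q)| ≤ lam i₀ * ‖perp (v i₀) q‖ ^ 2 := by
  have h1 : inner ℝ q (A q) = ∑ i, lam i * (inner ℝ (v i) q : ℝ) ^ 2 := by
    rw [← v.sum_inner_mul_inner q (A q)]
    refine Finset.sum_congr rfl fun i _ => ?_
    rw [inner_eigenbasis_apply hA, real_inner_comm]
    ring
  have h2 : ∑ i, (inner ℝ (v i) q : ℝ) ^ 2 = 1 := by
    have := v.sum_sq_norm_inner_right q
    simpa [hq] using this
  have hub : inner ℝ q (A q) ≤ lam i₀ := by
    rw [h1, ← mul_one (lam i₀), ← h2, Finset.mul_sum]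
    exact Finset.sum_le_sum fun i _ => mul_le_mul_of_nonneg_right (hle i) (sq_nonneg _)
  have hlb : lam i₀ * (inner ℝ (v i₀) q : ℝ) ^ 2 ≤ inner ℝ q (A q) := by
    rw [h1]
    exact Finset.single_le_sum (f := fun i => lam i * (inner ℝ (v i) q : ℝ) ^ 2)
      (fun i _ => mul_nonneg (hlam i) (sq_nonneg _)) (Finset.mem_univ i₀)
  rw [abs_of_nonneg (sub_nonneg.2 hub), norm_perp_sq (v.norm_eq_one i₀), hq]
  linarith

lemma norm_outer_sub_outer_apply_le {u q w : Vec d} (hu : ‖u‖ = 1) (hq : ‖q‖ = 1) (hw : ‖w‖ ≤ 1) :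
    ‖(outer u - outer q) w‖ ≤ 3 * ‖perp u q‖ := by
  set p := perp u q with hp
  set c : ℝ := inner ℝ u q with hc
  have hqe : q = c • u + p := by rw [hp, perp]; abel
  have hs := norm_perp_sq hu q
  rw [hq, ← hp, ← hc] at hs
  have hp1 : ‖p‖ ≤ 1 := hq ▸ norm_perp_le hu q
  have hc1 : |c| ≤ 1 := abs_inner_le_one hu hq
  have hin : ∀ z : Vec d, |inner ℝ z w| ≤ ‖z‖ := fun z =>
    (abs_real_inner_le_norm z w).trans (mul_le_of_le_one_right (norm_nonneg _) hw)
  -- Substituting `q = c u + p` and `1 - c² = ‖p‖²` leaves only terms containing `p`.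
  have heq : (outer u - outer q) w
      = (‖p‖ ^ 2 * inner ℝ u w - c * inner ℝ p w) • u - (inner ℝ q w : ℝ) • p := by
    have h1 : (inner ℝ q w : ℝ) = c * inner ℝ u w + inner ℝ p w := by
      conv_lhs => rw [hqe]
      rw [inner_add_left, real_inner_smul_left]
    rw [_root_.sub_apply, outer_apply, outer_apply]
    conv_lhs => rw [show (inner ℝ q w : ℝ) • q = (inner ℝ q w : ℝ) • (c • u + p) by rw [← hqe]]
    rw [h1, hs]
    module
  rw [heq]
  have ha : |‖p‖ ^ 2 * inner ℝ u w - c * inner ℝ p w| ≤ 2 * ‖p‖ := by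
    refine (abs_sub _ _).trans ?_
    rw [abs_mul, abs_mul, abs_of_nonneg (sq_nonneg ‖p‖)]
    have h1 := hin u
    have h2 := hin p
    rw [hu] at h1
    have h3 : ‖p‖ ^ 2 * |inner ℝ u w| ≤ ‖p‖ * 1 := by
      refine mul_le_mul ?_ h1 (abs_nonneg _) (norm_nonneg _)
      nlinarith [norm_nonneg p]
    have h4 : |c| * |inner ℝ p w| ≤ 1 * ‖p‖ := mul_le_mul hc1 h2 (abs_nonneg _) zero_le_one
    linarith
  refine (norm_sub_le _ _).trans ?_
  rw [norm_smul, norm_smul, hu, Real.norm_eq_abs, Real.norm_eq_abs]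
  have h5 := hin q
  rw [hq] at h5
  have h6 : |inner ℝ q w| * ‖p‖ ≤ 1 * ‖p‖ := mul_le_mul_of_nonneg_right h5 (norm_nonneg _)
  linarith

/-- The deflation error in terms of the entrywise error of the estimate `A'` and the angle between
`q` and the top eigenvector. -/
lemma norm_deflation_apply_le (hA : ∀ i, A (v i) = lam i • v i) (hlam : ∀ i, 0 ≤ lam i)
    {i₀ : Fin d} (hle : ∀ i, lam i ≤ lam i₀) {A' : Vec d →L[ℝ] Vec d} {η : ℝ} (hη : 0 ≤ η)
    (h : ∀ i j, |inner ℝ (v i) ((A' - A) (v j))| ≤ η) {q w : Vec d} (hq : ‖q‖ = 1)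
    (hw : ‖w‖ ≤ 1) :
    ‖(lam i₀ • outer (v i₀) - (inner ℝ q (A' q) : ℝ) • outer q) w‖
      ≤ d * η + 4 * (lam i₀ * ‖perp (v i₀) q‖) := by
  have hv := v.norm_eq_one i₀
  have hp1 : ‖perp (v i₀) q‖ ≤ 1 := hq ▸ norm_perp_le hv q
  have hν : |lam i₀ - inner ℝ q (A' q)| ≤ d * η + lam i₀ * ‖perp (v i₀) q‖ := by
    have h1 := abs_rayleigh_sub_le hA hlam hle hq
    have h2 := abs_inner_apply_le_of_entries v hη h hq
    rw [_root_.sub_apply, inner_sub_right, abs_sub_comm] at h2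
    have h3 := abs_add_le (lam i₀ - inner ℝ q (A q)) (inner ℝ q (A q) - inner ℝ q (A' q))
    rw [sub_add_sub_cancel] at h3
    have h4 : lam i₀ * ‖perp (v i₀) q‖ ^ 2 ≤ lam i₀ * ‖perp (v i₀) q‖ :=
      mul_le_mul_of_nonneg_left (by nlinarith [norm_nonneg (perp (v i₀) q)]) (hlam i₀)
    linarith
  have heq : (lam i₀ • outer (v i₀) - (inner ℝ q (A' q) : ℝ) • outer q) w
      = lam i₀ • (outer (v i₀) - outer q) w + (lam i₀ - inner ℝ q (A' q)) • outer q w := by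
    simp only [_root_.sub_apply, _root_.smul_apply]
    module
  have hout : ‖outer q w‖ ≤ 1 := by
    rw [outer_apply, norm_smul, hq, mul_one]
    exact (norm_inner_le_norm q w).trans (by rw [hq, one_mul]; exact hw)
  rw [heq]
  refine (norm_add_le _ _).trans ?_
  rw [norm_smul, norm_smul, Real.norm_eq_abs, Real.norm_eq_abs, abs_of_nonneg (hlam i₀)]
  have h5 := mul_le_mul_of_nonneg_left (norm_outer_sub_outer_apply_le hv hq hw) (hlam i₀)
  have h6 : |lam i₀ - inner ℝ q (A' q)| * ‖outer q w‖ ≤ |lam i₀ - inner ℝ q (A' q)| :=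
    mul_le_of_le_one_right (abs_nonneg _) hout
  linarith

end Deflation

/-! ### Iterating the power step -/

section Trajectory

variable {d : ℕ} {A : Vec d →L[ℝ] Vec d} {lam : Fin d → ℝ}
  {v : OrthonormalBasis (Fin d) ℝ (Vec d)}

/-- The trajectory of the streaming power method when the sampling error is entrywise at most
`η`. -/
lemma qIter_trajectory (hA : ∀ i, A (v i) = lam i • v i) (hlam : ∀ i, 0 ≤ lam i) {i₀ : Fin d}
    {l δ ε c₀ η : ℝ} (hl : 0 ≤ l) (hle : ∀ i, i ≠ i₀ → lam i ≤ l) (hδ : 0 < δ)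
    (hgap : lam i₀ = l + 4 * δ) (hε : 0 ≤ ε) (hc₀ : 0 < c₀) (hεc : ε ^ 2 ≤ 1 / c₀ ^ 2 - 1)
    (hε1 : ε ≤ 1) (hη : 0 ≤ η) (hη1 : Real.sqrt d * η ≤ ε * δ) (hη2 : η ≤ δ * c₀)
    {n : ℕ} {x : ℕ → Vec d} {q₀ : Vec d} (hq₀ : ‖q₀‖ = 1) (hqc : c₀ ≤ |inner ℝ (v i₀) q₀|)
    {T : ℕ} (h : ∀ t < T, ∀ i,
      |inner ℝ (v i) ((empCov n x (t + 1) - A) (qIter n x q₀ t))| ≤ η) {t : ℕ} (ht : t ≤ T) :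
    ‖qIter n x q₀ t‖ = 1 ∧ c₀ ≤ |inner ℝ (v i₀) (qIter n x q₀ t)| ∧
      tanAngle (v i₀) (qIter n x q₀ t)
        ≤ max ε (max ε (l / (l + δ)) ^ t * tanAngle (v i₀) q₀) := by
  induction t with
  | zero => exact ⟨hq₀, hqc, by simp [qIter]⟩
  | succ t ih =>
    obtain ⟨h1, h2, h3⟩ := ih (by omega)
    have hstep := noisy_power_step hA hlam hl hle hδ hgap hε hc₀ hεc h1 h2
      ((norm_le_of_abs_inner_basis_le v hη (h t ht)).trans hη1) ((h t ht i₀).trans hη2) hε1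
    have hEq : A (qIter n x q₀ t) + (empCov n x (t + 1) - A) (qIter n x q₀ t)
        = empCov n x (t + 1) (qIter n x q₀ t) := by
      rw [_root_.sub_apply]
      abel
    rw [hEq] at hstep
    obtain ⟨g1, g2, g3⟩ := hstep
    refine ⟨g1, g2, g3.trans (max_le (le_max_left _ _) ?_)⟩
    set ρ := max ε (l / (l + δ)) with hρ
    have hρ0 : 0 ≤ ρ := hε.trans (le_max_left _ _)
    have hρ1 : ρ ≤ 1 := max_le hε1 ((div_le_one (by positivity)).2 (by linarith))
    refine (mul_le_mul_of_nonneg_left h3 hρ0).trans ?_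
    rw [mul_max_of_nonneg _ _ hρ0, ← mul_assoc, ← pow_succ']
    exact max_le_max (mul_le_of_le_one_left hε hρ1) le_rfl

end Trajectory

/-! ### Scalar estimates for the rate and the batch size -/

section Bounds

lemma sqrt_min_le_psiBound (lam₁ lam₂ ε θ : ℝ) (t : ℕ) :
    Real.sqrt (min 1 (max (ε ^ 2) ((lam₂ / lam₁) ^ ((t : ℝ) / 2) * Real.tan θ ^ 2)))
      ≤ psiBound lam₁ lam₂ ε θ t := by
  unfold psiBound
  set z := min 1 (max (ε ^ 2) ((lam₂ / lam₁) ^ ((t : ℝ) / 2) * Real.tan θ ^ 2)) with hz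
  have hz0 : 0 ≤ z := le_min zero_le_one ((sq_nonneg ε).trans (le_max_left _ _))
  have hz1 : z ≤ 1 := min_le_left _ _
  refine Real.sqrt_le_sqrt ?_
  -- Consequently `2 - 2√(1 - z) ≥ z`.
  have : Real.sqrt (1 - z) ≤ 1 - z / 2 := by
    rw [Real.sqrt_le_left (by linarith)]
    nlinarith
  linarith

lemma le_sqrt_min_max_sq {ε R : ℝ} (hε : 0 ≤ ε) (hε1 : ε ≤ 1) :
    ε ≤ Real.sqrt (min 1 (max (ε ^ 2) R)) :=
  Real.le_sqrt_of_sq_le (le_min (pow_le_one₀ hε hε1) (le_max_left _ _))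

/-- The convergence rate of the noisy power method, in the form entering `psiBound`. -/
lemma mul_sin_le_of_rate {L s ε ρ₁ r T₀ D K : ℝ} {t : ℕ} (ht : 1 ≤ t) (hL : 0 ≤ L) (hL1 : L ≤ 1)
    (hs : 0 ≤ s) (hs1 : s ≤ 1) (hε : 0 ≤ ε) (hε1 : ε ≤ 1) (hρr : ρ₁ ^ 4 ≤ r)
    (hT : 0 ≤ T₀) (hTD : T₀ ≤ D) (hLD : L * D ≤ K)
    (h : s ≤ max ε (max ε ρ₁ ^ t * T₀)) :
    L * s ≤ (1 + K) * Real.sqrt (min 1 (max (ε ^ 2) (r ^ ((t : ℝ) / 2) * T₀ ^ 2))) := by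
  have hr : 0 ≤ r := le_trans (by positivity) hρr
  set z := Real.sqrt (min 1 (max (ε ^ 2) (r ^ ((t : ℝ) / 2) * T₀ ^ 2))) with hz
  have hK : 0 ≤ K := (mul_nonneg hL (hT.trans hTD)).trans hLD
  have hεz : ε ≤ z := le_sqrt_min_max_sq hε hε1
  have hz0 : 0 ≤ z := Real.sqrt_nonneg _
  rcases le_total ρ₁ ε with hc | hc
  -- If `ε` dominates the rate, one step already gives `s ≤ ε (1 + D)`; the possibly large `D` is
  -- absorbed by `L * D ≤ K`.
  · rw [max_eq_left hc] at h
    have h1 : ε ^ t ≤ ε := pow_le_of_le_one hε hε1 (by omega)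
    have h2 : s ≤ ε + ε * D := by
      refine h.trans (max_le (le_add_of_nonneg_right (mul_nonneg hε (hT.trans hTD))) ?_)
      have := mul_le_mul h1 hTD hT hε
      linarith
    calc L * s ≤ L * (ε + ε * D) := mul_le_mul_of_nonneg_left h2 hL
      _ = L * ε + ε * (L * D) := by ring
      _ ≤ 1 * ε + ε * K := by gcongr
      _ = (1 + K) * ε := by ring
      _ ≤ (1 + K) * z := by gcongr
  · rw [max_eq_right hc] at h
    have hrate : (ρ₁ ^ t) ^ 2 ≤ r ^ ((t : ℝ) / 2) := by
      have h1 : ρ₁ ^ 2 ≤ Real.sqrt r := Real.le_sqrt_of_sq_le (by rw [← pow_mul]; exact hρr)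
      have h2 : r ^ ((t : ℝ) / 2) = Real.sqrt r ^ t := by
        rw [Real.sqrt_eq_rpow, ← Real.rpow_natCast, ← Real.rpow_mul hr]
        congr 1
        ring
      rw [h2, ← pow_mul, mul_comm, pow_mul]
      exact pow_le_pow_left₀ (by positivity) h1 t
    have hsz : s ≤ z := by
      refine Real.le_sqrt_of_sq_le (le_min (pow_le_one₀ hs hs1) ?_)
      rcases le_max_iff.1 h with h | h
      · exact (pow_le_pow_left₀ hs h 2).trans (le_max_left _ _)
      · refine (pow_le_pow_left₀ hs h 2).trans (le_trans ?_ (le_max_right _ _))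
        rw [mul_pow]
        gcongr
    calc L * s ≤ 1 * z := mul_le_mul hL1 hsz hs zero_le_one
      _ ≤ (1 + K) * z := by gcongr; linarith

lemma one_le_log_of_three_le {d : ℕ} (hd : 3 ≤ d) : 1 ≤ Real.log d := by
  have h3 : (3 : ℝ) ≤ d := by exact_mod_cast hd
  rw [Real.le_log_iff_exp_le (by linarith)]
  linarith [Real.exp_one_lt_d9]

lemma half_le_log_of_two_le {n : ℕ} (hn : 2 ≤ n) : 1 / 2 ≤ Real.log n := by
  have h2 : (2 : ℝ) ≤ n := by exact_mod_cast hn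
  have := Real.log_le_log two_pos h2
  linarith [Real.log_two_gt_d9]

/-- What the batch size condition gives. -/
lemma batch_size_consequences {B τ M Δ ε C₀ : ℝ} (hB : 0 < B) (hτ : 1 ≤ τ) (hM : 0 < M)
    (hC₀ : C₀ = 1600 * B ^ 2 * τ ^ 2 + 16 * M ^ 2 * B ^ 2) (hΔ : 0 < Δ) (hε : 0 < ε) (hε1 : ε ≤ 1)
    {d n : ℕ} (hd : 3 ≤ d) (hn : 2 ≤ n) (hΔd : Δ ≤ M * (B / d))
    (h : C₀ * ((1 / ε ^ 2) * Real.log d / (Δ ^ 2 * d)) ≤ (n : ℝ) / Real.log n ^ 4) :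
    d ≤ n ∧ B / d * (5 * Real.log n / Real.sqrt n) ≤ ε * Δ / (4 * τ * Real.sqrt d) := by
  have hlogd := one_le_log_of_three_le hd
  have hlogn := half_le_log_of_two_le hn
  have hd0 : (0 : ℝ) < d := by positivity
  have hn0 : (0 : ℝ) < n := by positivity
  set ℓ := Real.log n
  have hℓ0 : 0 < ℓ := by linarith
  have hC₀0 : 0 < C₀ := by rw [hC₀]; positivity
  have hmain : C₀ * ℓ ^ 4 ≤ n * (ε ^ 2 * Δ ^ 2 * d) := by
    rw [le_div_iff₀ (by positivity)] at h
    have h1 : C₀ * (1 / ε ^ 2 * 1 / (Δ ^ 2 * d)) * ℓ ^ 4 ≤ n := by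
      refine le_trans ?_ h
      gcongr
    calc C₀ * ℓ ^ 4 = C₀ * (1 / ε ^ 2 * 1 / (Δ ^ 2 * d)) * ℓ ^ 4 * (ε ^ 2 * Δ ^ 2 * d) := by
          field_simp
      _ ≤ _ := by gcongr
  constructor
  -- The factor 16 in `C₀` offsets this bound. Then `d ≤ n` follows because the gap is itself
  -- `O(B/d)`.
  · have hℓ4 : 1 / 16 ≤ ℓ ^ 4 := by
      have := pow_le_pow_left₀ (by norm_num) hlogn 4
      norm_num at this ⊢
      exact this
    have h2 : M ^ 2 * B ^ 2 ≤ n * (Δ ^ 2 * d) := by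
      calc M ^ 2 * B ^ 2 = 16 * M ^ 2 * B ^ 2 * (1 / 16) := by ring
        _ ≤ C₀ * ℓ ^ 4 := by
            gcongr
            rw [hC₀]
            have : 0 ≤ 1600 * B ^ 2 * τ ^ 2 := by positivity
            linarith
        _ ≤ n * (ε ^ 2 * Δ ^ 2 * d) := hmain
        _ ≤ n * (1 * Δ ^ 2 * d) := by
            gcongr
            exact pow_le_one₀ hε.le hε1
        _ = _ := by ring
    have h3 : M ^ 2 * B ^ 2 ≤ n * ((M * (B / d)) ^ 2 * d) := h2.trans (by gcongr)
    have h4 : n * ((M * (B / d)) ^ 2 * d) = M ^ 2 * B ^ 2 * n / d := by field_simp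
    rw [h4, le_div_iff₀ hd0] at h3
    exact_mod_cast le_of_mul_le_mul_left h3 (by positivity)
  · have hsn : Real.sqrt n ^ 2 = n := Real.sq_sqrt hn0.le
    have hsd : Real.sqrt d ^ 2 = d := Real.sq_sqrt hd0.le
    have hsn0 : 0 < Real.sqrt n := Real.sqrt_pos.2 hn0
    have hsd0 : 0 < Real.sqrt d := Real.sqrt_pos.2 hd0
    -- Here `1600 = 20² · 4`, with `20 = 5 · 4` and the 4 coming from `ℓ² / 4 ≤ ℓ⁴`.
    have hkey : 20 * B * τ * ℓ ≤ ε * Δ * Real.sqrt d * Real.sqrt n := by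
      refine le_of_sq_le_sq ?_ (by positivity)
      calc (20 * B * τ * ℓ) ^ 2 = 1600 * B ^ 2 * τ ^ 2 * (ℓ ^ 2 * (1 / 2) ^ 2) := by ring
        _ ≤ C₀ * (ℓ ^ 2 * ℓ ^ 2) := by
            gcongr
            rw [hC₀]
            have : 0 ≤ 16 * M ^ 2 * B ^ 2 := by positivity
            linarith
        _ = C₀ * ℓ ^ 4 := by ring
        _ ≤ n * (ε ^ 2 * Δ ^ 2 * d) := hmain
        _ = (ε * Δ * Real.sqrt d * Real.sqrt n) ^ 2 := by
            rw [mul_pow, mul_pow, mul_pow, hsn, hsd]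
            ring
    rw [← hsd, div_mul_div_comm, div_le_div_iff₀ (by positivity) (by positivity),
      Real.sqrt_sq hsd0.le]
    calc B * (5 * ℓ) * (4 * τ * Real.sqrt d) = 20 * B * τ * ℓ * Real.sqrt d := by ring
      _ ≤ ε * Δ * Real.sqrt d * Real.sqrt n * Real.sqrt d := by gcongr
      _ = _ := by ring

end Bounds

/-! ### Union bound over one round, and the size of the eigenvalues -/

section Probability

variable {d : ℕ} {B : ℝ} {μ : Measure (Vec d)} [IsProbabilityMeasure μ]
  {Ω : Type*} [MeasurableSpace Ω] {P : Measure Ω} [IsProbabilityMeasure P]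
  {x : ℕ → Ω → Vec d}

/-- The sampling error of a single round is entrywise small, both along the basis and at the
current iterate, up to probability `O(1 / n³)`. -/
lemma IsRound.measure_round_le (h : IsRound B μ) (hb : 0 < B / d)
    (hx : ∀ i, Measurable (x i)) (hlaw : ∀ i, P.map (x i) = μ) (hind : iIndepFun x P)
    (v : OrthonormalBasis (Fin d) ℝ (Vec d)) {q₀ : Vec d} (hq₀ : ‖q₀‖ = 1) {n : ℕ} (hn : 1 ≤ n)
    (hdn : d ≤ n) (t : ℕ) :
    P {ω | ∃ i, B / d * (5 * Real.log n / Real.sqrt n)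
          < |inner ℝ (v i) ((empCov n (fun i => x i ω) (t + 1) - covMatrix μ)
            (qIter n (fun i => x i ω) q₀ t))| ∨
        ∃ j, B / d * (5 * Real.log n / Real.sqrt n)
          < |inner ℝ (v i) ((empCov n (fun i => x i ω) (t + 1) - covMatrix μ) (v j))|}
      ≤ ENNReal.ofReal (4 * (Real.exp (expTailMoment 4) + expTailMoment 24) / (n : ℝ) ^ 3) := by
  set η := B / d * (5 * Real.log n / Real.sqrt n) with hη
  set K := Real.exp (expTailMoment 4) + expTailMoment 24 with hK
  have hK0 : 0 < K := by
    have := one_le_expTailMoment 24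
    positivity
  have hn0 : (0 : ℝ) < n := by exact_mod_cast hn
  have hbd : ∀ i (q : Vec d), ‖q‖ ≤ 1 → P {ω | η < |inner ℝ (v i)
      ((empCov n (fun i => x i ω) (t + 1) - covMatrix μ) q)|}
      ≤ ENNReal.ofReal (2 * K / (n : ℝ) ^ 5) := fun i q hq =>
    h.measure_abs_inner_empCov_sub_gt_le hb hx hlaw hind (v.norm_eq_one i).le hq hn
      (Nat.le_add_left 1 t)
  have hbq := fun i => measure_inner_qIter_gt_le hx hind n t hq₀.le (covMatrix μ) (v i) η _ (hbd i)
  have hsub : ∀ i, P ({ω | η < |inner ℝ (v i)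
      ((empCov n (fun i => x i ω) (t + 1) - covMatrix μ) (qIter n (fun i => x i ω) q₀ t))|} ∪
      ⋃ j, {ω | η < |inner ℝ (v i)
        ((empCov n (fun i => x i ω) (t + 1) - covMatrix μ) (v j))|})
      ≤ ENNReal.ofReal (2 * K / (n : ℝ) ^ 5) + d * ENNReal.ofReal (2 * K / (n : ℝ) ^ 5) := by
    intro i
    refine (measure_union_le _ _).trans (add_le_add (hbq i) ?_)
    refine (measure_iUnion_fintype_le _ _).trans ?_
    refine (Finset.sum_le_card_nsmul _ _ _ fun j _ => hbd i (v j) (v.norm_eq_one j).le).trans ?_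
    simp
  have hset : {ω | ∃ i, η < |inner ℝ (v i)
        ((empCov n (fun i => x i ω) (t + 1) - covMatrix μ) (qIter n (fun i => x i ω) q₀ t))| ∨
        ∃ j, η < |inner ℝ (v i) ((empCov n (fun i => x i ω) (t + 1) - covMatrix μ) (v j))|}
      ⊆ ⋃ i, ({ω | η < |inner ℝ (v i)
      ((empCov n (fun i => x i ω) (t + 1) - covMatrix μ) (qIter n (fun i => x i ω) q₀ t))|} ∪
      ⋃ j, {ω | η < |inner ℝ (v i)
        ((empCov n (fun i => x i ω) (t + 1) - covMatrix μ) (v j))|}) := by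
    rintro ω ⟨i, hi⟩
    refine Set.mem_iUnion.2 ⟨i, hi.imp id fun ⟨j, hj⟩ => Set.mem_iUnion.2 ⟨j, hj⟩⟩
  refine (measure_mono hset).trans ((measure_iUnion_fintype_le _ _).trans ?_)
  refine (Finset.sum_le_card_nsmul _ _ _ fun i _ => hsub i).trans ?_
  rw [Finset.card_univ, Fintype.card_fin, nsmul_eq_mul, ← ENNReal.ofReal_natCast d,
    ← ENNReal.ofReal_mul (by positivity), ← ENNReal.ofReal_add (by positivity) (by positivity),
    ← ENNReal.ofReal_mul (by positivity)]
  refine ENNReal.ofReal_le_ofReal ?_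
  have hdn' : (d : ℝ) ≤ n := by exact_mod_cast hdn
  have hn1 : (1 : ℝ) ≤ n := by exact_mod_cast hn
  calc (d : ℝ) * (2 * K / (n : ℝ) ^ 5 + d * (2 * K / (n : ℝ) ^ 5))
      ≤ n * (n * (2 * K / (n : ℝ) ^ 5) + n * (2 * K / (n : ℝ) ^ 5)) := by
        gcongr
        exact le_mul_of_one_le_left (by positivity) hn1
    _ = 4 * K / (n : ℝ) ^ 3 := by
        field_simp
        ring

lemma IsRound.eigenvalue_nonneg_and_le (h : IsRound B μ) (hb : 0 < B / d) {l : ℝ} {u : Vec d}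
    (hu : ‖u‖ = 1) (hl : covMatrix μ u = l • u) :
    0 ≤ l ∧ l ≤ expTailMoment 2 * (B / d) := by
  have h1 : l = B / d * ∫ y, scaledEntry B u u y ∂μ := by
    rw [← h.inner_covMatrix hb, hl, real_inner_smul_right, real_inner_self_eq_norm_sq, hu]
    ring
  have h0 : ∀ y, 0 ≤ scaledEntry B u u y := fun y => mul_self_nonneg _
  have h2 := h.integral_scaledEntry_pow_le hb hu.le hu.le 1
  simp only [pow_one, mul_one, abs_of_nonneg (h0 _)] at h2
  rw [h1, mul_comm]
  exact ⟨mul_nonneg (integral_nonneg h0) hb.le, mul_le_mul_of_nonneg_right h2 hb.le⟩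

end Probability

/-! ### The main theorem -/

theorem mainTheorem5 (B τ : ℝ) (hB : 0 < B) (hτ : 1 ≤ τ) :
    -- the implied constants: of the batch size, of the bound, and of the failure probability
    ∃ C₀ C₁ C₂ : ℝ, 0 < C₀ ∧ 0 < C₁ ∧ 0 < C₂ ∧
      ∀ (d : ℕ) (hd : 3 ≤ d)
        -- the law of the stream, with covariance matrix `A = covMatrix μ` and its eigenpairs
        (μ : Measure (Vec d)) (_ : IsProbabilityMeasure μ) (_ : IsRound B μ)
        (lam : Fin d → ℝ) (v : OrthonormalBasis (Fin d) ℝ (Vec d))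
        (_ : ∀ i, covMatrix μ (v i) = lam i • v i) (_ : Antitone lam)
        (_ : lam ⟨0, by omega⟩ ≤ 1)
        (_ : lam ⟨1, by omega⟩ < lam ⟨0, by omega⟩)
        (_ : lam ⟨2, by omega⟩ < lam ⟨1, by omega⟩)
        -- the i.i.d. stream
        (Ω : Type*) (_ : MeasurableSpace Ω) (P : Measure Ω) (_ : IsProbabilityMeasure P)
        (x : ℕ → Ω → Vec d) (_ : ∀ i, Measurable (x i)) (_ : ∀ i, P.map (x i) = μ)
        (_ : iIndepFun x P)
        -- the initial vectors
        (q₀ w₀ : Vec d) (_ : ‖q₀‖ = 1) (_ : ‖w₀‖ = 1)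
        (_ : 1 / (τ * Real.sqrt d) ≤ |inner ℝ q₀ (v ⟨0, by omega⟩)|)
        -- the accuracy and the batch size
        (ε : ℝ) (_ : 0 < ε) (_ : ε < 1 / 2)
        (n : ℕ) (_ : 2 ≤ n)
        (_ : C₀ * ((1 / ε ^ 2) * Real.log d
              / ((lam ⟨0, by omega⟩ - lam ⟨1, by omega⟩) ^ 2 * d))
            ≤ (n : ℝ) / Real.log n ^ 4)
        -- the number of rounds
        (T : ℕ) (_ : 1 ≤ T),
        P {ω | ∃ t : ℕ, 1 ≤ t ∧ t ≤ T ∧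
            C₁ * max
              (phiBound d (lam ⟨0, by omega⟩) (lam ⟨1, by omega⟩) (lam ⟨d - 1, by omega⟩) ε
                (lineAngle q₀ (v ⟨0, by omega⟩)) t)
              (psiBound (lam ⟨0, by omega⟩) (lam ⟨1, by omega⟩) ε
                (lineAngle q₀ (v ⟨0, by omega⟩)) t)
            < ‖deflationError n (fun i => x i ω) q₀ w₀ (lam ⟨0, by omega⟩)
                (v ⟨0, by omega⟩) t‖}
          ≤ ENNReal.ofReal (C₂ * max 1 ((T : ℝ) / n) / (n : ℝ) ^ 2) := by
  set M := expTailMoment 2 with hMdef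
  set K := Real.exp (expTailMoment 4) + expTailMoment 24 with hKdef
  have hM : 0 < M := zero_lt_one.trans_le (one_le_expTailMoment 2)
  have hK : 0 < K := by
    have := one_le_expTailMoment 24
    positivity
  -- In `C₁`, the first `M * B * τ` pays for `d * η`, and `4 * (1 + M * B * τ)` for the angle term.
  refine ⟨1600 * B ^ 2 * τ ^ 2 + 16 * M ^ 2 * B ^ 2, M * B * τ + 4 * (1 + M * B * τ), 4 * K,
    by positivity, by positivity, by positivity, ?_⟩
  intro d hd μ _ hround lam v hA hanti hlam1 hgap _ Ω _ P _ x hx hlaw hind q₀ w₀ hq₀ hw₀ hq₀v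
    ε hε hε2 n hn hsize T hT
  set i₀ : Fin d := ⟨0, by omega⟩ with hi₀
  set i₁ : Fin d := ⟨1, by omega⟩ with hi₁
  have hd3 : (3 : ℝ) ≤ d := by exact_mod_cast hd
  have hd0 : (0 : ℝ) < d := by linarith
  have hn0 : (0 : ℝ) < n := by positivity
  have hb : 0 < B / d := by positivity
  have hτ0 : 0 < τ := by linarith
  have hε1 : ε ≤ 1 := by linarith
  have hv := v.norm_eq_one i₀
  have heig := fun i => hround.eigenvalue_nonneg_and_le hb (v.norm_eq_one i) (hA i)
  have hlam : ∀ i, 0 ≤ lam i := fun i => (heig i).1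
  have hle₀ : ∀ i, lam i ≤ lam i₀ := fun i => hanti (Nat.zero_le _)
  have hle₁ : ∀ i, i ≠ i₀ → lam i ≤ lam i₁ := fun i hi => hanti (by
    have : (i : ℕ) ≠ 0 := fun h0 => hi (Fin.ext h0)
    exact Nat.one_le_iff_ne_zero.2 this)
  set δ := (lam i₀ - lam i₁) / 4 with hδdef
  have hδ : 0 < δ := by rw [hδdef]; linarith
  have hΔ : 0 < lam i₀ - lam i₁ := by linarith
  set sd := Real.sqrt d with hsd
  have hsd2 : sd ^ 2 = d := Real.sq_sqrt hd0.le
  have hsd0 : 0 < sd := Real.sqrt_pos.2 hd0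
  have hsd1 : 1 ≤ sd := Real.one_le_sqrt.2 (by linarith)
  set c₀ := 1 / (τ * sd) with hc₀
  have hc₀0 : 0 < c₀ := by positivity
  obtain ⟨hdn, hη⟩ := batch_size_consequences hB hτ hM rfl hΔ hε hε1 hd hn
    (by linarith [(heig i₀).2, hlam i₁]) hsize
  set η := B / d * (5 * Real.log n / Real.sqrt n) with hηdef
  have hη0 : 0 ≤ η := by
    have := half_le_log_of_two_le hn
    positivity
  have hη' : η ≤ ε * δ * c₀ := hη.trans (le_of_eq (by rw [hδdef, hc₀, ← hsd]; field_simp))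
  have hη1 : sd * η ≤ ε * δ := by
    calc sd * η ≤ sd * (ε * δ * c₀) := by gcongr
      _ = ε * δ / τ := by rw [hc₀]; field_simp
      _ ≤ ε * δ := div_le_self (by positivity) hτ
  have hη2 : η ≤ δ * c₀ := hη'.trans (by
    rw [mul_assoc]
    exact mul_le_of_le_one_left (by positivity) hε1)
  have hεc : ε ^ 2 ≤ 1 / c₀ ^ 2 - 1 := by
    have h1 : 1 / c₀ ^ 2 = τ ^ 2 * d := by rw [hc₀, ← hsd2]; field_simp
    have h2 : ε ^ 2 ≤ 1 := pow_le_one₀ hε.le hε1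
    have h3 : (1 : ℝ) * 3 ≤ τ ^ 2 * d := by
      gcongr
      exact one_le_pow₀ hτ
    rw [h1]
    linarith
  have hLD : lam i₀ * (τ * sd) ≤ M * B * τ := by
    calc lam i₀ * (τ * sd) ≤ M * (B / d) * (τ * sd) := by
          gcongr
          exact (heig i₀).2
      _ = M * B * τ / sd := by rw [← hsd2]; field_simp
      _ ≤ M * B * τ := div_le_self (by positivity) hsd1
  have hqc : c₀ ≤ |inner ℝ (v i₀) q₀| := by rwa [real_inner_comm]
  have htan0 : tanAngle (v i₀) q₀ ≤ τ * sd := by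
    refine (tanAngle_le_inv hv hq₀).trans ?_
    rw [show τ * sd = c₀⁻¹ by rw [hc₀, one_div, inv_inv]]
    gcongr
  have hdη : d * η ≤ M * B * τ * ε := by
    calc d * η = sd * (sd * η) := by rw [← hsd2]; ring
      _ ≤ sd * (ε * δ) := by gcongr
      _ ≤ (τ * sd) * (ε * lam i₀) := by
          gcongr
          · exact le_mul_of_one_le_left hsd0.le hτ
          · rw [hδdef]
            linarith [hlam i₀, hlam i₁]
      _ = lam i₀ * (τ * sd) * ε := by ring
      _ ≤ _ := by gcongr
  have hsub : {ω | ∃ t : ℕ, 1 ≤ t ∧ t ≤ T ∧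
      (M * B * τ + 4 * (1 + M * B * τ)) * max
        (phiBound d (lam i₀) (lam i₁) (lam ⟨d - 1, by omega⟩) ε (lineAngle q₀ (v i₀)) t)
        (psiBound (lam i₀) (lam i₁) ε (lineAngle q₀ (v i₀)) t)
      < ‖deflationError n (fun i => x i ω) q₀ w₀ (lam i₀) (v i₀) t‖} ⊆
      ⋃ s ∈ Finset.range T, {ω | ∃ i, η < |inner ℝ (v i)
          ((empCov n (fun i => x i ω) (s + 1) - covMatrix μ)
            (qIter n (fun i => x i ω) q₀ s))| ∨
        ∃ j, η < |inner ℝ (v i)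
          ((empCov n (fun i => x i ω) (s + 1) - covMatrix μ) (v j))|} := by
    rintro ω ⟨t, ht1, htT, hlt⟩
    by_contra hgood
    simp only [Set.mem_iUnion, Finset.mem_range, not_exists] at hgood
    have hgood1 : ∀ s < T, ∀ i, |inner ℝ (v i)
        ((empCov n (fun i => x i ω) (s + 1) - covMatrix μ)
          (qIter n (fun i => x i ω) q₀ s))| ≤ η := fun s hs i =>
      not_lt.1 fun hh => hgood s hs ⟨i, Or.inl hh⟩
    have hgood2 : ∀ s < T, ∀ i j, |inner ℝ (v i)
        ((empCov n (fun i => x i ω) (s + 1) - covMatrix μ) (v j))| ≤ η := fun s hs i j =>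
      not_lt.1 fun hh => hgood s hs ⟨i, Or.inr ⟨j, hh⟩⟩
    obtain ⟨hq1, hq2, hq3⟩ := qIter_trajectory hA hlam (hlam i₁) hle₁ hδ
      (by rw [hδdef]; ring) hε.le hc₀0 hεc hε1 hη0 hη1 hη2 hq₀ hqc hgood1 htT
    have hin : inner ℝ (v i₀) (qIter n (fun i => x i ω) q₀ t) ≠ (0 : ℝ) :=
      abs_pos.1 (hc₀0.trans_le hq2)
    -- Round `t` has error index `s = t - 1`.
    have hent := hgood2 (t - 1) (by omega)
    rw [Nat.sub_add_cancel ht1] at hent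
    have hG := norm_deflation_apply_le hA hlam hle₀ hη0 hent hq1
      (norm_wIter_le_one (n := n) (x := fun i => x i ω) (q₀ := q₀) hw₀.le (t - 1))
    have hρr : (lam i₁ / (lam i₁ + δ)) ^ 4 ≤ lam i₁ / lam i₀ := by
      have := pow_four_div_add_le (hlam i₁) hδ
      rwa [show lam i₁ + 4 * δ = lam i₀ by rw [hδdef]; ring] at this
    have hsin := mul_sin_le_of_rate ht1 (hlam i₀) hlam1 (norm_nonneg _)
      (hq1 ▸ norm_perp_le hv (qIter n (fun i => x i ω) q₀ t)) hε.le hε1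
      hρr (tanAngle_nonneg _ _) htan0 hLD
      ((norm_perp_le_tanAngle hv hq1 hin).trans hq3)
    have hpsi := sqrt_min_le_psiBound (lam i₀) (lam i₁) ε (lineAngle q₀ (v i₀)) t
    rw [tan_lineAngle_sq hv hq₀] at hpsi
    have hεz := le_sqrt_min_max_sq (R := (lam i₁ / lam i₀) ^ ((t : ℝ) / 2)
      * tanAngle (v i₀) q₀ ^ 2) hε.le hε1
    set z := Real.sqrt (min 1 (max (ε ^ 2) ((lam i₁ / lam i₀) ^ ((t : ℝ) / 2)
      * tanAngle (v i₀) q₀ ^ 2)))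
    have hfinal : ‖deflationError n (fun i => x i ω) q₀ w₀ (lam i₀) (v i₀) t‖
        ≤ (M * B * τ + 4 * (1 + M * B * τ)) * max
        (phiBound d (lam i₀) (lam i₁) (lam ⟨d - 1, by omega⟩) ε (lineAngle q₀ (v i₀)) t)
        (psiBound (lam i₀) (lam i₁) ε (lineAngle q₀ (v i₀)) t) := by
      calc _ ≤ d * η + 4 * (lam i₀ * ‖perp (v i₀) (qIter n (fun i => x i ω) q₀ t)‖) := hG
        _ ≤ M * B * τ * z + 4 * ((1 + M * B * τ) * z) := by
            refine add_le_add (hdη.trans ?_) (mul_le_mul_of_nonneg_left hsin (by norm_num))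
            gcongr
        _ = (M * B * τ + 4 * (1 + M * B * τ)) * z := by ring
        _ ≤ _ := by
            gcongr
            exact hpsi.trans (le_max_right _ _)
    exact absurd hlt (not_lt.2 hfinal)
  refine (measure_mono hsub).trans ((measure_biUnion_finset_le _ _).trans ?_)
  refine (Finset.sum_le_card_nsmul _ _ _ fun s _ =>
    hround.measure_round_le hb hx hlaw hind v hq₀ (by omega) hdn s).trans ?_
  rw [Finset.card_range, nsmul_eq_mul, ← ENNReal.ofReal_natCast,
    ← ENNReal.ofReal_mul (Nat.cast_nonneg T)]
  refine ENNReal.ofReal_le_ofReal ?_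
  -- One of the three powers of `n` is spent on the ratio `T / n`.
  calc (T : ℝ) * (4 * K / (n : ℝ) ^ 3) = 4 * K * (T / n) / (n : ℝ) ^ 2 := by field_simp
    _ ≤ _ := by
        gcongr
        exact le_max_right _ _
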